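/- **Theorem 4.1.** Let $\Omega\subset\mathbb R^3$ be a bounded Lipschitz domain with exterior unit normal $\nu$, let $\Gamma\subset\partial\Omega$ be relatively open, and let $\omega,\varepsilon_0,\mu_0>0$. Let $\varepsilon,\mu\in L^\infty(\Omega;\mathbb R_+)$ and $\sigma\in L^\infty(\Omega;\mathbb R_+\cup\{0\})$, and put $\gamma=\varepsilon+\mathrm i\sigma/\omega$. Let $(\mathbf E^t,\mathbf H^t)$ and $(\mathbf E^0,\mathbf H^0)$ be electromagnetic transmission eigenfunctions for the eigenvalue $\omega$; that is, $\mathbf E^t,\mathbf H^t,\mathbf E^0,\mathbf H^0\in H(\mathrm{curl},\Omega)$ are not all zero and satisfy $$\nabla\wedge\mathbf E^t-\mathrm i\omega\mu\mathbf H^t=\mathbf 0,\quad \nabla\wedge\mathbf H^t+\mathrm i\omega\gamma\mathbf E^t=\mathbf 0\quad\text{in }\Omega,$$ $$\nabla\wedge\mathbf E^0-\mathrm i\omega\mu_0\mathbf H^0=\mathbf 0,\quad \nabla\wedge\mathbf H^0+\mathrm i\omega\varepsilon_0\mathbf E^0=\mathbf 0\quad\text{in }\Omega$$ in the sense of distributions,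 and $$\nu\wedge\mathbf E^t=\nu\wedge\mathbf E^0,\quad \nu\wedge\mathbf H^t=\nu\wedge\mathbf H^0\quad\text{on }\Gamma$$ in the sense of traces. Suppose that $\Omega$ has a conical corner at a point $\mathbf x_0\in\Gamma$: for some unit vector $\mathbf a$, some $\theta_0\in(0,\pi/2)$ and some $r_0>0$, $$\Omega\cap B_{r_0}(\mathbf x_0)=\mathcal K_{r_0}:=\{\mathbf x\in B_{r_0}(\mathbf x_0)\setminus\{\mathbf x_0\}:\ \angle(\mathbf x-\mathbf x_0,\mathbf a)<\theta_0\}.$$ Suppose further that, for some $\alpha\in(0,1)$, the fields $(\mu-\mu_0)\mathbf H^t$ and $(\gamma-\varepsilon_0)\mathbf E^t$ belong to $C^\alpha(\overline{\mathcal K_{r_0}})^3$, i.e. agree almost everywhere in $\mathcal K_{r_0}$ with such fields. Then the values of these Hölder continuous fields at the apex are zero: $$\big((\mu-\mu_0)\mathbf H^t\big)(\mathbf x_0)=\big((\gamma-\varepsilon_0)\mathbf E^t\big)(\mathbf x_0)=\mathbf 0.$$ Furthermore, write $f(\mathbf x_0)$ for the essential limit of $f(\mathbf x)$ as $\mathbf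 x\to\mathbf x_0$ in $\mathcal K_{r_0}$. If $\mu(\mathbf x_0)$ exists and $\mu(\mathbf x_0)\neq\mu_0$, then $\mathbf H^t(\mathbf x_0)$ exists and equals $\mathbf 0$; if $\gamma(\mathbf x_0)$ exists and $\gamma(\mathbf x_0)\neq\varepsilon_0$, then $\mathbf E^t(\mathbf x_0)$ exists and equals $\mathbf 0$. -/

import Mathlib

open MeasureTheory Filter Topology
open scoped NNReal

noncomputable section

/-- Three-dimensional Euclidean space. -/
abbrev R3 : Type := EuclideanSpace ℝ (Fin 3)

/-- The space of complex vector values of a field. -/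
abbrev C3 : Type := EuclideanSpace ℂ (Fin 3)

/-- The bilinear (not sesquilinear) product `a · b = ∑ aᵢ bᵢ` on `ℂ³`. -/
def dotC (a b : C3) : ℂ := ∑ i, a i * b i

/-- The partial derivative `∂ⱼ φᵢ (x)` of a complex vector field on `ℝ³`. -/
def partialDeriv (φ : R3 → C3) (j i : Fin 3) (x : R3) : ℂ :=
  (fderiv ℝ φ x (EuclideanSpace.single j 1)) i

/-- The classical curl `∇ ∧ φ` of a (differentiable) complex vector field on `ℝ³`. -/
def curl (φ : R3 → C3) (x : R3) : C3 :=
  !₂[partialDeriv φ 1 2 x - partialDeriv φ 2 1 x,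
     partialDeriv φ 2 0 x - partialDeriv φ 0 2 x,
     partialDeriv φ 0 1 x - partialDeriv φ 1 0 x]

/-- Smooth compactly supported vector fields on all of `ℝ³`. -/
def IsTestField (φ : R3 → C3) : Prop := ContDiff ℝ ((⊤ : ℕ∞) : WithTop ℕ∞) φ ∧ HasCompactSupport φ

/-- `c` is the curl of `u` in `Ω` in the sense of distributions:
`∫_Ω c · φ = ∫_Ω u · (∇ ∧ φ)` for all test fields supported inside `Ω`. -/
def IsWeakCurl (Ω : Set R3) (u c : R3 → C3) : Prop :=
  ∀ φ : R3 → C3, IsTestField φ → tsupport φ ⊆ Ω →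
    ∫ x in Ω, dotC (c x) (φ x) = ∫ x in Ω, dotC (u x) (curl φ x)

/-- `u ∈ L²(Ω; ℂ³)` with weak curl `c ∈ L²(Ω; ℂ³)`. -/
structure HasL2Curl (Ω : Set R3) (u c : R3 → C3) : Prop where
  memLp : MemLp u 2 (volume.restrict Ω)
  memLp_curl : MemLp c 2 (volume.restrict Ω)
  isWeakCurl : IsWeakCurl Ω u c

/-- The space `H(curl, Ω)`. -/
def MemHCurl (Ω : Set R3) (u : R3 → C3) : Prop := ∃ c, HasL2Curl Ω u c

/-- The tangential trace `ν ∧ u` of a field `u ∈ H(curl, Ω)` with curl `c`, as a functional on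
test fields: `⟨ν ∧ u, φ⟩ = ∫_Ω (∇ ∧ u) · φ - u · (∇ ∧ φ)`. By the divergence theorem this is
`∫_{∂Ω} (ν ∧ u) · φ dσ`, with `ν` the exterior unit normal, when `u` is smooth up to the
boundary of a Lipschitz domain. -/
def tangentialTrace (Ω : Set R3) (u c φ : R3 → C3) : ℂ :=
  ∫ x in Ω, (dotC (c x) (φ x) - dotC (u x) (curl φ x))

/-- `ν ∧ u = ν ∧ v` on the relatively open part `Γ` of `∂Ω`, for `u, v ∈ H(curl, Ω)`: the two
tangential traces agree on all test fields whose support meets `∂Ω` only inside `Γ`. -/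
def TangentialTraceEqOn (Ω Γ : Set R3) (u v : R3 → C3) : Prop :=
  ∃ cu cv : R3 → C3, HasL2Curl Ω u cu ∧ HasL2Curl Ω v cv ∧
    ∀ φ : R3 → C3, IsTestField φ → tsupport φ ∩ frontier Ω ⊆ Γ →
      tangentialTrace Ω u cu φ = tangentialTrace Ω v cv φ

/-- Bounded Lipschitz domains in `ℝ³`: bounded, open, connected, and near each boundary point,
after a rigid motion `T`, the region above the graph of a Lipschitz function. -/
structure IsBoundedLipschitzDomain (Ω : Set R3) : Prop where
  isOpen : IsOpen Ω
  isConnected : IsConnected Ω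
  isBounded : Bornology.IsBounded Ω
  lipschitz_boundary : ∀ p ∈ frontier Ω, ∃ r : ℝ, 0 < r ∧
    ∃ (T : R3 ≃ᵃⁱ[ℝ] R3) (L : ℝ≥0) (g : EuclideanSpace ℝ (Fin 2) → ℝ), LipschitzWith L g ∧
      Ω ∩ Metric.ball p r = {x | g !₂[T x 0, T x 1] < T x 2} ∩ Metric.ball p r

/-- `Γ` is a relatively open subset of `∂Ω`. -/
def IsRelOpenBoundaryPart (Ω Γ : Set R3) : Prop :=
  ∃ U : Set R3, IsOpen U ∧ Γ = frontier Ω ∩ U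

/-- The open circular cone with apex `x₀`, axis `a` and opening angle `2 θ₀`. -/
def cone (x₀ a : R3) (θ₀ : ℝ) : Set R3 :=
  {x | x ≠ x₀ ∧ InnerProductGeometry.angle (x - x₀) a < θ₀}

/-- The cone truncated by the ball of radius `r₀` around its apex. -/
def truncatedCone (x₀ a : R3) (θ₀ r₀ : ℝ) : Set R3 :=
  cone x₀ a θ₀ ∩ Metric.ball x₀ r₀

/-- The complex coefficient `γ = ε + i σ / ω`. -/
def gammaCoeff (ω : ℝ) (ε σ : R3 → ℝ) (x : R3) : ℂ :=
  (ε x : ℂ) + Complex.I * (σ x : ℂ) / (ω : ℂ)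

/-- Admissible medium parameters: `ε, μ ∈ L^∞(Ω; ℝ₊)` and `σ ∈ L^∞(Ω; ℝ₊ ∪ {0})`. -/
structure IsMedium (Ω : Set R3) (ε μ σ : R3 → ℝ) : Prop where
  memLp_eps : MemLp ε ⊤ (volume.restrict Ω)
  memLp_mu : MemLp μ ⊤ (volume.restrict Ω)
  memLp_sigma : MemLp σ ⊤ (volume.restrict Ω)
  eps_pos : ∀ᵐ x ∂(volume.restrict Ω), 0 < ε x
  mu_pos : ∀ᵐ x ∂(volume.restrict Ω), 0 < μ x
  sigma_nonneg : ∀ᵐ x ∂(volume.restrict Ω), 0 ≤ σ x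

/-- `(E^t, H^t)` and `(E^0, H^0)` are electromagnetic transmission eigenfunctions for the
eigenvalue `ω`, with transmission conditions on the part `Γ` of `∂Ω`. -/
structure IsTransmissionEigenfunctions (Ω Γ : Set R3) (ω ε₀ μ₀ : ℝ) (ε μ σ : R3 → ℝ)
    (Et Ht E0 H0 : R3 → C3) : Prop where
  memHCurl_Et : MemHCurl Ω Et
  memHCurl_Ht : MemHCurl Ω Ht
  memHCurl_E0 : MemHCurl Ω E0
  memHCurl_H0 : MemHCurl Ω H0
  curl_Et : IsWeakCurl Ω Et (fun x => (Complex.I * (ω : ℂ) * (μ x : ℂ)) • Ht x)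
  curl_Ht : IsWeakCurl Ω Ht (fun x => (-(Complex.I * (ω : ℂ) * gammaCoeff ω ε σ x)) • Et x)
  curl_E0 : IsWeakCurl Ω E0 (fun x => (Complex.I * (ω : ℂ) * (μ₀ : ℂ)) • H0 x)
  curl_H0 : IsWeakCurl Ω H0 (fun x => (-(Complex.I * (ω : ℂ) * (ε₀ : ℂ))) • E0 x)
  trace_E : TangentialTraceEqOn Ω Γ Et E0
  trace_H : TangentialTraceEqOn Ω Γ Ht H0
  nontrivial : ¬ (Et =ᵐ[volume.restrict Ω] 0 ∧ Ht =ᵐ[volume.restrict Ω] 0 ∧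
    E0 =ᵐ[volume.restrict Ω] 0 ∧ H0 =ᵐ[volume.restrict Ω] 0)

/-- `F` is a representative in `C^α` of the closure of `K` of the field `f`, which is given
almost everywhere on `K`. -/
def IsHolderRepresentative (K : Set R3) (α : ℝ≥0) (f F : R3 → C3) : Prop :=
  (∃ C : ℝ≥0, HolderOnWith C α F (closure K)) ∧ F =ᵐ[volume.restrict K] f

/-- The value at the point `x₀` of the closure of `K` of a function given almost everywhere on
`K`: `f` has the essential limit `v` as `x → x₀` in `K`, that is, every neighbourhood of `v`
contains `f x` for almost all `x ∈ K` in some neighbourhood of `x₀`. -/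
def HasEssValueAt {V : Type*} [TopologicalSpace V] (K : Set R3) (f : R3 → V) (x₀ : R3) (v : V) :
    Prop :=
  Tendsto f (ae (volume.restrict K) ⊓ 𝓝 x₀) (𝓝 v)

end

/-!
Put `u = E^t - E^0` and `v = H^t - H^0`. Near the apex their tangential traces vanish, so that
`curl u = f + A v` and `curl v = g + D u` up to and including the boundary, with `A`, `D` constant
and with the sources `f = i ω (μ - μ₀) H^t` and `g = -i ω (γ - ε₀) E^t`.

Let `b` be a unit vector orthogonal to the axis `a`, and `σ² = 1 + A D / τ²`. The adjoint system has
the solutions `p e^ℓ`, `q e^ℓ` with `ℓ y = τ (-a · y + i σ b · y)`, `p = (D / τ) a ∧ b` and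
`q = b + i σ a`; they decay exponentially in the cone as `τ → ∞`. Testing with a cut-off of this
solution leaves only the sources, and after multiplication by `τ³` the limit is
`J (b + i a) · g x₀ = 0`, where `J` is the integral of `exp (-a · y + i b · y)` over the infinite
cone. Integrating along the axis and then radially, `J` is the integral of `(cot θ₀ - i cos φ)⁻²`
over the circle, which a primitive reduces to a positive multiple of the integral of
`(cot θ₀ - i cos φ)⁻¹`, whose real part is positive. Hence `(b + i a) · g x₀ = 0` for all such `b`;
comparing `b` with `-b` gives `g x₀ = 0`. Exchanging the two equations gives `f x₀ = 0`.
-/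

/-! ### Exponentials concentrating at the apex of a cone -/

theorem exists_ae_eq_tendsto {X Y : Type*} [MeasurableSpace X] {μ : Measure X}
    [TopologicalSpace Y] [FirstCountableTopology Y] {l : Filter X} {f : X → Y} {y : Y}
    (hf : Tendsto f (ae μ ⊓ l) (𝓝 y)) : ∃ g, g =ᵐ[μ] f ∧ Tendsto g l (𝓝 y) := by
  classical
  obtain ⟨s, hs⟩ := (𝓝 y).exists_antitone_basis
  have hgood : ∀ n, ∃ t ∈ l, ∀ᵐ x ∂μ, x ∈ t → f x ∈ s n := fun n => by
    obtain ⟨u, hu, t, ht, hut⟩ := mem_inf_iff_superset.1 (hf (hs.mem n))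
    exact ⟨t, ht, mem_of_superset hu fun x hxu hxt => hut ⟨hxu, hxt⟩⟩
  choose t ht hft using hgood
  refine ⟨fun x => if ∀ n, x ∈ t n → f x ∈ s n then f x else y, ?_, ?_⟩
  · filter_upwards [ae_all_iff.2 hft] with x hx using if_pos hx
  · refine hs.toHasBasis.tendsto_right_iff.2 fun n _ => ?_
    filter_upwards [ht n] with x hx
    split_ifs with hgood
    · exact hgood n hx
    · exact mem_of_mem_nhds (hs.mem n)

section Laplace

open Module (finrank)

variable {V : Type*} [NormedAddCommGroup V] [NormedSpace ℝ V] {C : Set V} {L : ℝ → V →L[ℝ] ℂ}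
  {L₀ : V →L[ℝ] ℂ} {c : ℝ}

theorem eventually_forall_re_le (hc : 0 < c) (hL : Tendsto (fun τ => τ⁻¹ • L τ) atTop (𝓝 L₀))
    (hre : ∀ y ∈ C, (L₀ y).re ≤ -(c * ‖y‖)) :
    ∀ᶠ τ in atTop, ∀ y ∈ C, (L τ y).re ≤ -(c / 2 * (τ * ‖y‖)) := by
  filter_upwards [hL.eventually (Metric.ball_mem_nhds L₀ (half_pos hc)), eventually_gt_atTop 0]
    with τ hτ hpos y hy
  have hle : ((τ⁻¹ • L τ - L₀) y).re ≤ c / 2 * ‖y‖ :=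
    (Complex.re_le_norm _).trans <| (τ⁻¹ • L τ - L₀).le_of_opNorm_le
      (mem_ball_iff_norm.1 hτ).le y
  have hscaled : τ⁻¹ * (L τ y).re ≤ -(c / 2 * ‖y‖) := by
    simp only [sub_apply, smul_apply, Complex.sub_re, Complex.smul_re, smul_eq_mul] at hle
    linarith [hre y hy]
  calc (L τ y).re = τ * (τ⁻¹ * (L τ y).re) := by field_simp
    _ ≤ τ * -(c / 2 * ‖y‖) := by gcongr
    _ = -(c / 2 * (τ * ‖y‖)) := by ring

theorem tendsto_indicator_cexp_inv_smul (hCsmul : ∀ t : ℝ, 0 < t → ∀ y ∈ C, t • y ∈ C)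
    (hL : Tendsto (fun τ => τ⁻¹ • L τ) atTop (𝓝 L₀)) {r : ℝ} (hr : 0 < r) (y : V) :
    Tendsto (fun τ : ℝ => (C ∩ Metric.ball 0 r).indicator (fun y => Complex.exp (L τ y)) (τ⁻¹ • y))
      atTop (𝓝 (C.indicator (fun y => Complex.exp (L₀ y)) y)) := by
  by_cases hy : y ∈ C
  · have hsmall : Tendsto (fun τ : ℝ => τ⁻¹ • y) atTop (𝓝 0) := by
      simpa using (tendsto_inv_atTop_zero (𝕜 := ℝ)).smul_const y
    have hlim : Tendsto (fun τ => Complex.exp ((τ⁻¹ • L τ) y)) atTop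
        (𝓝 (Complex.exp (L₀ y))) :=
      (Complex.continuous_exp.tendsto _).comp
        (((ContinuousLinearMap.apply ℝ ℂ y).continuous.tendsto _).comp hL)
    rw [Set.indicator_of_mem hy]
    refine hlim.congr' ?_
    filter_upwards [hsmall.eventually (Metric.ball_mem_nhds 0 hr), eventually_gt_atTop 0]
      with τ hτ hpos
    have hmem : τ⁻¹ • y ∈ C ∩ Metric.ball 0 r := ⟨hCsmul _ (inv_pos.2 hpos) y hy, hτ⟩
    rw [Set.indicator_of_mem hmem, map_smul, smul_apply]
  · rw [Set.indicator_of_notMem hy]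
    refine tendsto_const_nhds.congr' ?_
    filter_upwards [eventually_gt_atTop 0] with τ hpos
    refine (Set.indicator_of_notMem (fun h => hy ?_) _).symm
    simpa [smul_smul, hpos.ne'] using hCsmul τ hpos _ h.1

variable [FiniteDimensional ℝ V] [MeasurableSpace V] [BorelSpace V] (μ : Measure V)
  [μ.IsAddHaarMeasure]

theorem integrable_exp_neg_mul_norm (hc : 0 < c) :
    Integrable (fun x : V => Real.exp (-(c * ‖x‖))) μ := by
  rcases subsingleton_or_nontrivial V with _ | _
  · exact (integrable_const (1 : ℝ)).congr (ae_of_all _ fun x => by simp [Subsingleton.elim x 0])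
  rw [integrable_fun_norm_addHaar μ (f := fun t => Real.exp (-(c * t)))]
  have h := integrableOn_rpow_mul_exp_neg_mul_rpow (s := ((finrank ℝ V - 1 : ℕ) : ℝ)) (p := 1)
    (neg_one_lt_zero.trans_le (Nat.cast_nonneg _)) one_pos hc
  simpa using h

theorem tendsto_pow_mul_integral_exp_neg_mul_norm (hc : 0 < c) {x₀ : V} {h : V → ℝ}
    (hh : Integrable h μ) (hcont : ContinuousAt h x₀) :
    Tendsto (fun τ : ℝ => τ ^ finrank ℝ V * ∫ x, Real.exp (-(c * (τ * ‖x - x₀‖))) * h x ∂μ) atTop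
      (𝓝 ((∫ y, Real.exp (-(c * ‖y‖)) ∂μ) * h x₀)) := by
  set I := ∫ y, Real.exp (-(c * ‖y‖)) ∂μ with hI
  have hI0 : 0 < I := integral_exp_pos (integrable_exp_neg_mul_norm μ hc)
  have hdecay : Tendsto (fun y : V => ‖y‖ ^ finrank ℝ V * (I⁻¹ * Real.exp (-(c * ‖y‖))))
      (Bornology.cobounded V) (𝓝 0) := by
    have h1 := (tendsto_rpow_mul_exp_neg_mul_atTop_nhds_zero (finrank ℝ V) c hc).comp
      (tendsto_norm_cobounded_atTop (E := V))
    simpa [Function.comp_def, mul_left_comm] using h1.const_mul I⁻¹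
  have hpeak := tendsto_integral_comp_smul_smul_of_integrable' (μ := μ)
    (φ := fun y => I⁻¹ * Real.exp (-(c * ‖y‖))) (fun y => by positivity)
    (by rw [integral_const_mul, ← hI, inv_mul_cancel₀ hI0.ne']) hdecay hh hcont
  refine (hpeak.const_mul I).congr' ?_
  filter_upwards [eventually_ge_atTop 0] with τ hτ
  rw [← integral_const_mul, ← integral_const_mul]
  refine integral_congr_ae (ae_of_all _ fun x => ?_)
  simp only [smul_eq_mul, norm_smul, Real.norm_of_nonneg hτ, norm_sub_rev x₀ x]
  field_simp

theorem pow_smul_setIntegral_comp_sub {S : Set V} (hS : MeasurableSet S) (F : V → ℂ) (x₀ : V)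
    {τ : ℝ} (hτ : 0 ≤ τ) :
    τ ^ finrank ℝ V • ∫ x in (· - x₀) ⁻¹' S, F (x - x₀) ∂μ = ∫ y, S.indicator F (τ⁻¹ • y) ∂μ := by
  rw [Measure.integral_comp_inv_smul_of_nonneg μ _ hτ,
    ← integral_sub_right_eq_self (S.indicator F) x₀,
    ← integral_indicator (measurable_sub_const x₀ hS)]
  rfl

theorem tendsto_pow_smul_setIntegral_cexp (hCm : MeasurableSet C)
    (hCsmul : ∀ t : ℝ, 0 < t → ∀ y ∈ C, t • y ∈ C) (hc : 0 < c)
    (hL : Tendsto (fun τ => τ⁻¹ • L τ) atTop (𝓝 L₀)) (hre : ∀ y ∈ C, (L₀ y).re ≤ -(c * ‖y‖))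
    (x₀ : V) {r : ℝ} (hr : 0 < r) :
    Tendsto (fun τ : ℝ => τ ^ finrank ℝ V •
      ∫ x in (· - x₀) ⁻¹' (C ∩ Metric.ball 0 r), Complex.exp (L τ (x - x₀)) ∂μ) atTop
      (𝓝 (∫ y in C, Complex.exp (L₀ y) ∂μ)) := by
  set S := C ∩ Metric.ball (0 : V) r
  have hS : MeasurableSet S := hCm.inter measurableSet_ball
  have hscale : ∀ᶠ τ in atTop, ∫ y, S.indicator (fun y => Complex.exp (L τ y)) (τ⁻¹ • y) ∂μ =
      τ ^ finrank ℝ V • ∫ x in (· - x₀) ⁻¹' S, Complex.exp (L τ (x - x₀)) ∂μ := by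
    filter_upwards [eventually_ge_atTop 0] with τ hτ
    exact (pow_smul_setIntegral_comp_sub μ hS _ x₀ hτ).symm
  rw [← integral_indicator hCm]
  refine Tendsto.congr' hscale <| tendsto_integral_filter_of_dominated_convergence
    (fun y => Real.exp (-(c / 2 * ‖y‖))) (Eventually.of_forall fun τ => ?_) ?_
    (integrable_exp_neg_mul_norm μ (half_pos hc)) (ae_of_all _ fun y => ?_)
  · exact (((by fun_prop : Measurable fun y => Complex.exp (L τ y)).indicator hS).comp
      (measurable_const_smul τ⁻¹)).aestronglyMeasurable
  · filter_upwards [eventually_forall_re_le hc hL hre, eventually_gt_atTop 0] with τ hτ hpos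
    refine ae_of_all _ fun y => ?_
    by_cases hy : τ⁻¹ • y ∈ S
    · rw [Set.indicator_of_mem hy, Complex.norm_exp, Real.exp_le_exp]
      refine (hτ _ hy.1).trans_eq ?_
      rw [norm_smul, Real.norm_of_nonneg (inv_pos.2 hpos).le, mul_inv_cancel_left₀ hpos.ne']
    · rw [Set.indicator_of_notMem hy, norm_zero]
      positivity
  · exact tendsto_indicator_cexp_inv_smul hCsmul hL hr y

theorem tendsto_pow_smul_setIntegral_cexp_smul_zero {E : Type*} [NormedAddCommGroup E]
    [NormedSpace ℂ E] (hc : 0 < c) (hL : Tendsto (fun τ => τ⁻¹ • L τ) atTop (𝓝 L₀))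
    (hre : ∀ y ∈ C, (L₀ y).re ≤ -(c * ‖y‖)) {x₀ : V} {K : Set V} (hK : MeasurableSet K)
    (hKC : ∀ x ∈ K, x - x₀ ∈ C) {h : V → E} (hh : IntegrableOn h K μ)
    (hh₀ : Tendsto h (𝓝 x₀) (𝓝 0)) :
    Tendsto (fun τ : ℝ => τ ^ finrank ℝ V • ∫ x in K, Complex.exp (L τ (x - x₀)) • h x ∂μ)
      atTop (𝓝 0) := by
  have hind : Tendsto (K.indicator fun x => ‖h x‖) (𝓝 x₀) (𝓝 0) :=
    squeeze_zero (Set.indicator_nonneg fun x _ => norm_nonneg (h x))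
      (Set.indicator_le_self' fun x _ => norm_nonneg (h x))
      (tendsto_zero_iff_norm_tendsto_zero.1 hh₀)
  have hval : K.indicator (fun x => ‖h x‖) x₀ = 0 :=
    tendsto_nhds_unique (tendsto_pure_nhds _ x₀) (hind.mono_left (pure_le_nhds x₀))
  have hint : Integrable (K.indicator fun x => ‖h x‖) μ := (integrable_indicator_iff hK).2 hh.norm
  have hpeak := tendsto_pow_mul_integral_exp_neg_mul_norm μ (half_pos hc) hint
    (by rwa [ContinuousAt, hval])
  rw [hval, mul_zero] at hpeak
  refine squeeze_zero_norm' ?_ hpeak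
  filter_upwards [eventually_forall_re_le hc hL hre, eventually_ge_atTop 0] with τ hτ hpos
  rw [norm_smul, Real.norm_of_nonneg (pow_nonneg hpos _), ← integral_indicator hK]
  gcongr
  refine norm_integral_le_of_norm_le (hint.bdd_mul (c := 1) (by fun_prop) <|
    ae_of_all _ fun x => ?_) (ae_of_all _ fun x => ?_)
  · rw [Real.norm_of_nonneg (Real.exp_pos _).le, Real.exp_le_one_iff]
    exact neg_nonpos.2 (by positivity)
  · by_cases hx : x ∈ K
    · rw [Set.indicator_of_mem hx, Set.indicator_of_mem hx, norm_smul, Complex.norm_exp]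
      gcongr
      exact hτ _ (hKC x hx)
    · simp only [Set.indicator_of_notMem hx, norm_zero, mul_zero, le_refl]

theorem tendsto_pow_smul_setIntegral_cexp_smul {E : Type*} [NormedAddCommGroup E]
    [NormedSpace ℂ E] [CompleteSpace E] (hCm : MeasurableSet C)
    (hCsmul : ∀ t : ℝ, 0 < t → ∀ y ∈ C, t • y ∈ C) (hc : 0 < c)
    (hL : Tendsto (fun τ => τ⁻¹ • L τ) atTop (𝓝 L₀))
    (hre : ∀ y ∈ C, (L₀ y).re ≤ -(c * ‖y‖)) {x₀ : V} {r : ℝ} (hr : 0 < r) {f : V → E} {f₀ : E}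
    (hf : IntegrableOn f ((· - x₀) ⁻¹' (C ∩ Metric.ball 0 r)) μ)
    (hf₀ : Tendsto f (ae (μ.restrict ((· - x₀) ⁻¹' (C ∩ Metric.ball 0 r))) ⊓ 𝓝 x₀) (𝓝 f₀)) :
    Tendsto (fun τ : ℝ => τ ^ finrank ℝ V •
      ∫ x in (· - x₀) ⁻¹' (C ∩ Metric.ball 0 r), Complex.exp (L τ (x - x₀)) • f x ∂μ) atTop
      (𝓝 ((∫ y in C, Complex.exp (L₀ y) ∂μ) • f₀)) := by
  set K := (· - x₀) ⁻¹' (C ∩ Metric.ball 0 r)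
  have hKm : MeasurableSet K := measurable_sub_const x₀ (hCm.inter measurableSet_ball)
  have hKball : K ⊆ Metric.ball x₀ r := fun x hx => mem_ball_iff_norm.2 (mem_ball_zero_iff.1 hx.2)
  have hcexp : ∀ (τ : ℝ) {h : V → E}, IntegrableOn h K μ →
      IntegrableOn (fun x => Complex.exp (L τ (x - x₀)) • h x) K μ := fun τ h hh =>
    hh.continuousOn_smul_of_subset (by fun_prop) (isCompact_closedBall x₀ r) hKm
      (hKball.trans Metric.ball_subset_closedBall)
  have hKfin : IsFiniteMeasure (μ.restrict K) :=
    isFiniteMeasure_restrict.2 (measure_ne_top_of_subset hKball measure_ball_lt_top.ne)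
  obtain ⟨g, hgf, hg⟩ := exists_ae_eq_tendsto hf₀
  have hgint : IntegrableOn (fun x => g x - f₀) K μ :=
    (hf.congr hgf.symm).sub (integrable_const f₀)
  have hrem := tendsto_pow_smul_setIntegral_cexp_smul_zero μ hc hL hre hKm (fun x hx => hx.1) hgint
    (by simpa using hg.sub_const f₀)
  have hmain := (tendsto_pow_smul_setIntegral_cexp μ hCm hCsmul hc hL hre x₀ hr).smul_const f₀
  rw [← zero_add ((∫ y in C, Complex.exp (L₀ y) ∂μ) • f₀)]
  refine (hrem.add hmain).congr fun τ => ?_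
  rw [smul_assoc, ← smul_add, ← integral_smul_const,
    ← integral_add (hcexp τ hgint) (hcexp τ (integrable_const f₀))]
  congr 1
  refine integral_congr_ae ?_
  filter_upwards [hgf] with x hx
  rw [smul_sub, sub_add_cancel, hx]

end Laplace

/-! ### The angular integral -/

theorem integrableOn_id_mul_exp_neg_mul_Ioi {c : ℝ} (hc : 0 < c) :
    IntegrableOn (fun r : ℝ => r * Real.exp (-(c * r))) (Set.Ioi 0) := by
  simpa using integrableOn_rpow_mul_exp_neg_mul_rpow (s := 1) (p := 1) (by norm_num) one_pos hc

theorem integral_ofReal_mul_cexp_neg_mul_Ioi {z : ℂ} (hz : 0 < z.re) :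
    ∫ r in Set.Ioi (0 : ℝ), (r : ℂ) * Complex.exp (-(z * r)) = 1 / z ^ 2 := by
  have hz0 : z ≠ 0 := fun h => by simp [h] at hz
  have hnorm : ∀ r : ℝ, ‖Complex.exp (-(z * r))‖ = Real.exp (-(z.re * r)) := fun r => by
    simp [Complex.norm_exp]
  have hdecay : ∀ n : ℕ,
      Tendsto (fun r : ℝ => (r : ℂ) ^ n * Complex.exp (-(z * r))) atTop (𝓝 0) := fun n => by
    have h := (tendsto_rpow_mul_exp_neg_mul_atTop_nhds_zero n z.re hz).norm
    simp only [norm_zero] at h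
    refine tendsto_zero_iff_norm_tendsto_zero.2 (h.congr fun r => ?_)
    simp [hnorm]
  have hderiv : ∀ r : ℝ, HasDerivAt
      (fun r : ℝ => -(1 / z * ((r : ℂ) ^ 1 * Complex.exp (-(z * r))) +
        1 / z ^ 2 * ((r : ℂ) ^ 0 * Complex.exp (-(z * r)))))
      ((r : ℂ) * Complex.exp (-(z * r))) r := fun r => by
    have hr : HasDerivAt (fun r : ℝ => (r : ℂ)) 1 r := Complex.ofRealCLM.hasDerivAt
    have hexp := (hr.const_mul z).fun_neg.cexp
    refine ((((hr.pow 1).mul hexp).const_mul (1 / z)).add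
      (((hr.pow 0).mul hexp).const_mul (1 / z ^ 2))).neg.congr_deriv ?_
    simp
    field_simp
    ring
  have hint : IntegrableOn (fun r : ℝ => (r : ℂ) * Complex.exp (-(z * r))) (Set.Ioi 0) :=
    (integrableOn_id_mul_exp_neg_mul_Ioi hz).norm.mono' (by fun_prop)
      (ae_of_all _ fun r => by simp [hnorm])
  have hlim := (((hdecay 1).const_mul (1 / z)).add ((hdecay 0).const_mul (1 / z ^ 2))).neg
  rw [integral_Ioi_of_hasDerivAt_of_tendsto' (fun r _ => hderiv r) hint hlim]
  simp

section Angular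

variable {c : ℝ}

theorem ofReal_sub_I_mul_cos_ne_zero (hc : c ≠ 0) (φ : ℝ) : (c : ℂ) - Complex.I * Real.cos φ ≠ 0 :=
  fun h => hc (by simpa using congrArg Complex.re h)

theorem continuous_one_div_sub_I_mul_cos_pow (hc : c ≠ 0) (n : ℕ) :
    Continuous fun φ : ℝ => 1 / ((c : ℂ) - Complex.I * Real.cos φ) ^ n :=
  continuous_const.div (by fun_prop) fun φ => pow_ne_zero n (ofReal_sub_I_mul_cos_ne_zero hc φ)

theorem hasDerivAt_sin_div_sub_I_mul_cos (hc : c ≠ 0) (φ : ℝ) :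
    HasDerivAt (fun φ : ℝ => -Complex.I * (Real.sin φ / (c - Complex.I * Real.cos φ)))
      (c * (1 / (c - Complex.I * Real.cos φ) ^ 1) -
        (1 + c ^ 2) * (1 / (c - Complex.I * Real.cos φ) ^ 2)) φ := by
  have hD := ofReal_sub_I_mul_cos_ne_zero hc φ
  have hsin := (Real.hasDerivAt_sin φ).ofReal_comp
  have hcos := ((Real.hasDerivAt_cos φ).ofReal_comp.const_mul Complex.I).const_sub (c : ℂ)
  refine ((hsin.div hcos hD).const_mul (-Complex.I)).congr_deriv ?_
  have hsq : (Real.sin φ : ℂ) ^ 2 + (Real.cos φ : ℂ) ^ 2 = 1 := by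
    exact_mod_cast Real.sin_sq_add_cos_sq φ
  rw [Complex.ofReal_neg]
  field_simp
  linear_combination Complex.I ^ 2 * hsq + Complex.I_sq

theorem mul_integral_one_div_sub_I_mul_cos (hc : c ≠ 0) :
    (c : ℂ) * ∫ φ in (-Real.pi)..Real.pi, 1 / ((c : ℂ) - Complex.I * Real.cos φ) ^ 1 =
      (1 + c ^ 2) * ∫ φ in (-Real.pi)..Real.pi, 1 / ((c : ℂ) - Complex.I * Real.cos φ) ^ 2 := by
  have hint : ∀ (z : ℂ) (n : ℕ), IntervalIntegrable
      (fun φ : ℝ => z * (1 / ((c : ℂ) - Complex.I * Real.cos φ) ^ n)) volume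
      (-Real.pi) Real.pi := fun z n =>
    (continuous_const.mul (continuous_one_div_sub_I_mul_cos_pow hc n)).intervalIntegrable _ _
  have h := intervalIntegral.integral_eq_sub_of_hasDerivAt
    (fun φ _ => hasDerivAt_sin_div_sub_I_mul_cos hc φ) ((hint c 1).sub (hint (1 + c ^ 2) 2))
  rw [intervalIntegral.integral_sub (hint _ _) (hint _ _), intervalIntegral.integral_const_mul,
    intervalIntegral.integral_const_mul] at h
  simpa [sub_eq_zero] using h

theorem integral_one_div_sub_I_mul_cos_sq_ne_zero (hc : 0 < c) :
    ∫ φ in (-Real.pi)..Real.pi, 1 / ((c : ℂ) - Complex.I * Real.cos φ) ^ 2 ≠ 0 := by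
  have hre : ∀ φ : ℝ, (1 / ((c : ℂ) - Complex.I * Real.cos φ) ^ 1).re =
      c / (c ^ 2 + Real.cos φ ^ 2) := fun φ => by
    simp [Complex.normSq_apply, sq, -Complex.ofReal_cos]
  have hpos : 0 < (∫ φ in (-Real.pi)..Real.pi, 1 / ((c : ℂ) - Complex.I * Real.cos φ) ^ 1).re := by
    have hcont := continuous_one_div_sub_I_mul_cos_pow hc.ne' 1
    rw [← Complex.reCLM_apply, ← Complex.reCLM.intervalIntegral_comp_comm
      (hcont.intervalIntegrable _ _)]
    refine intervalIntegral.intervalIntegral_pos_of_pos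
      ((Complex.continuous_re.comp hcont).intervalIntegrable _ _) (fun φ => ?_)
      (by linarith [Real.pi_pos])
    rw [Complex.reCLM_apply, hre]
    positivity
  intro h
  have hzero := mul_integral_one_div_sub_I_mul_cos hc.ne'
  rw [h, mul_zero, mul_eq_zero_iff_left (Complex.ofReal_ne_zero.2 hc.ne')] at hzero
  exact hpos.ne' (by rw [hzero, Complex.zero_re])

end Angular

theorem integral_cexp_neg_mul_norm_add_I_mul_re {c : ℝ} (hc : 0 < c) :
    ∫ q : ℂ, Complex.exp (-(c * ‖q‖ : ℝ) + Complex.I * q.re) =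
      ∫ φ in (-Real.pi)..Real.pi, 1 / ((c : ℂ) - Complex.I * Real.cos φ) ^ 2 := by
  let f : ℝ × ℝ → ℂ := fun p => p.1 * Complex.exp (-((c - Complex.I * Real.cos p.2) * p.1))
  have hf : Integrable f ((volume.restrict (Set.Ioi 0)).prod
      (volume.restrict (Set.Ioo (-Real.pi) Real.pi))) := by
    refine ((integrableOn_id_mul_exp_neg_mul_Ioi hc).mul_prod
      (integrable_const (1 : ℝ))).norm.mono' (by fun_prop) (ae_of_all _ fun p => ?_)
    simp [f, Complex.norm_exp]
  rw [← Complex.integral_comp_polarCoord_symm, polarCoord_target,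
    setIntegral_congr_fun (g := f) (measurableSet_Ioi.prod measurableSet_Ioo),
    Measure.volume_eq_prod, ← Measure.prod_restrict, integral_prod_symm _ hf,
    intervalIntegral.integral_of_le (by linarith [Real.pi_pos]), integral_Ioc_eq_integral_Ioo]
  · congr 1 with φ
    exact integral_ofReal_mul_cexp_neg_mul_Ioi (z := c - Complex.I * Real.cos φ) (by simpa using hc)
  · intro p hp
    have hr : 0 < p.1 := hp.1
    have hre : (Complex.polarCoord.symm p).re = p.1 * Real.cos p.2 := by
      simp [Complex.polarCoord_symm_apply, -Complex.ofReal_cos]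
    beta_reduce
    rw [Complex.norm_polarCoord_symm, abs_of_pos hr, hre, Complex.real_smul]
    congr 2
    push_cast
    ring

/-! ### Circular cones -/

theorem mem_cone_iff {x₀ a x : R3} {θ : ℝ} (ha : ‖a‖ = 1) (hθ : 0 ≤ θ) (hθπ : θ ≤ Real.pi) :
    x ∈ cone x₀ a θ ↔ Real.cos θ * ‖x - x₀‖ < inner ℝ a (x - x₀) := by
  by_cases hx : x = x₀
  · simp [cone, hx]
  have hnorm : 0 < ‖x - x₀‖ := norm_pos_iff.2 (sub_ne_zero.2 hx)
  have hinner := InnerProductGeometry.cos_angle_mul_norm_mul_norm (x - x₀) a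
  rw [ha, mul_one, real_inner_comm] at hinner
  rw [← hinner, mul_lt_mul_iff_left₀ hnorm, Real.strictAntiOn_cos.lt_iff_gt ⟨hθ, hθπ⟩
    ⟨InnerProductGeometry.angle_nonneg _ _, InnerProductGeometry.angle_le_pi _ _⟩]
  exact and_iff_right hx

theorem isOpen_cone {x₀ a : R3} {θ : ℝ} (ha : ‖a‖ = 1) (hθ : 0 ≤ θ) (hθπ : θ ≤ Real.pi) :
    IsOpen (cone x₀ a θ) := by
  have hcone : cone x₀ a θ = {x | Real.cos θ * ‖x - x₀‖ < inner ℝ a (x - x₀)} :=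
    Set.ext fun x => mem_cone_iff ha hθ hθπ
  rw [hcone]
  exact isOpen_lt (by fun_prop) (by fun_prop)

theorem smul_mem_cone {a y : R3} {θ t : ℝ} (ht : 0 < t) (hy : y ∈ cone 0 a θ) :
    t • y ∈ cone 0 a θ := by
  refine ⟨smul_ne_zero ht.ne' hy.1, ?_⟩
  simpa only [sub_zero, InnerProductGeometry.angle_smul_left_of_pos _ _ ht] using hy.2

theorem truncatedCone_eq_preimage (x₀ a : R3) (θ r : ℝ) :
    truncatedCone x₀ a θ r = (· - x₀) ⁻¹' (cone 0 a θ ∩ Metric.ball 0 r) := by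
  ext x
  simp [truncatedCone, cone, sub_eq_zero, dist_eq_norm]

theorem mem_closure_truncatedCone {x₀ a : R3} {θ r : ℝ} (ha : a ≠ 0) (hθ : 0 < θ) (hr : 0 < r) :
    x₀ ∈ closure (truncatedCone x₀ a θ r) := by
  have hlim : Tendsto (fun t : ℝ => x₀ + t • a) (𝓝[>] 0) (𝓝 x₀) := by
    have hcont : Continuous fun t : ℝ => x₀ + t • a := by fun_prop
    simpa using (hcont.tendsto 0).mono_left nhdsWithin_le_nhds
  refine mem_closure_of_tendsto hlim ?_
  filter_upwards [hlim (Metric.ball_mem_nhds x₀ hr), self_mem_nhdsWithin] with t ht hpos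
  refine ⟨⟨by simpa using ⟨(Set.mem_Ioi.1 hpos).ne', ha⟩, ?_⟩, ht⟩
  rwa [add_sub_cancel_left, InnerProductGeometry.angle_smul_left_of_pos _ _ hpos,
    InnerProductGeometry.angle_self ha]

theorem cos_mul_sqrt_lt_iff {θ : ℝ} (hθ : 0 < θ) (hθ' : θ < Real.pi / 2) {t ρ : ℝ} (hρ : 0 ≤ ρ) :
    Real.cos θ * √(t ^ 2 + ρ ^ 2) < t ↔ Real.cot θ * ρ < t := by
  have hcos : 0 < Real.cos θ := Real.cos_pos_of_mem_Ioo ⟨by linarith, hθ'⟩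
  have hsin : 0 < Real.sin θ := Real.sin_pos_of_pos_of_lt_pi hθ (by linarith)
  rw [Real.cot_eq_cos_div_sin, div_mul_eq_mul_div, div_lt_iff₀ hsin]
  rcases le_or_gt t 0 with ht | ht
  · exact iff_of_false (not_lt.2 (ht.trans (by positivity)))
      (not_lt.2 ((mul_nonpos_of_nonpos_of_nonneg ht hsin.le).trans (by positivity)))
  · have hleft : 0 ≤ Real.cos θ * √(t ^ 2 + ρ ^ 2) := by positivity
    have hright : 0 ≤ Real.cos θ * ρ := by positivity
    rw [← sq_lt_sq₀ hleft ht.le, ← sq_lt_sq₀ hright (by positivity), mul_pow, mul_pow, mul_pow,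
      Real.sq_sqrt (by positivity), Real.sin_sq]
    constructor <;> intro h <;> linarith

theorem exists_measurePreserving_coord (B : OrthonormalBasis (Fin 3) ℝ R3) :
    ∃ e : ℝ × ℂ ≃ᵐ R3, MeasurePreserving e ∧ ∀ t q, inner ℝ (B 0) (e (t, q)) = t ∧
      inner ℝ (B 1) (e (t, q)) = q.re ∧ inner ℝ (B 2) (e (t, q)) = q.im := by
  let e₁ : ℝ × ℂ ≃ᵐ ℝ × (Fin 2 → ℝ) := (MeasurableEquiv.refl ℝ).prodCongr Complex.measurableEquivPi
  let e₂ : ℝ × (Fin 2 → ℝ) ≃ᵐ (Fin 3 → ℝ) :=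
    (MeasurableEquiv.piFinSuccAbove (fun _ : Fin 3 => ℝ) 0).symm
  let e₃ : (Fin 3 → ℝ) ≃ᵐ R3 := (MeasurableEquiv.toLp 2 (Fin 3 → ℝ)).trans B.measurableEquiv.symm
  have he₁ : MeasurePreserving e₁ volume volume :=
    (MeasurePreserving.id volume).prod Complex.volume_preserving_equiv_pi
  have he₂ : MeasurePreserving e₂ volume volume :=
    (volume_preserving_piFinSuccAbove (fun _ : Fin 3 => ℝ) 0).symm _
  have he₃ : MeasurePreserving e₃ volume volume :=
    B.measurePreserving_repr_symm.comp (PiLp.volume_preserving_toLp (Fin 3))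
  refine ⟨(e₁.trans e₂).trans e₃, he₃.comp (he₂.comp he₁), fun t q => ?_⟩
  have hrepr : B.repr (e₃ (e₂ (e₁ (t, q)))) = WithLp.toLp 2 (e₂ (e₁ (t, q))) :=
    B.repr.apply_symm_apply _
  simp only [MeasurableEquiv.trans_apply, ← B.repr_apply_apply, hrepr]
  exact ⟨rfl, rfl, rfl⟩

theorem integrableOn_cone_cexp {a b : R3} {θ : ℝ} (ha : ‖a‖ = 1) (hθ : 0 ≤ θ)
    (hθ' : θ < Real.pi / 2) :
    IntegrableOn (fun y : R3 => Complex.exp (-(inner ℝ a y : ℝ) + Complex.I * (inner ℝ b y : ℝ)))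
      (cone 0 a θ) := by
  have hθπ : θ ≤ Real.pi := by linarith [Real.pi_pos]
  have hcos : 0 < Real.cos θ := Real.cos_pos_of_mem_Ioo ⟨by linarith, hθ'⟩
  refine (integrable_exp_neg_mul_norm volume hcos).integrableOn.mono' (by fun_prop)
    (ae_restrict_of_forall_mem (isOpen_cone ha hθ hθπ).measurableSet fun y hy => ?_)
  have hle := ((mem_cone_iff ha hθ hθπ).1 hy).le
  rw [sub_zero] at hle
  simpa [Complex.norm_exp] using hle

theorem integral_cone_cexp (B : OrthonormalBasis (Fin 3) ℝ R3) {θ : ℝ} (hθ : 0 < θ)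
    (hθ' : θ < Real.pi / 2) :
    ∫ y in cone 0 (B 0) θ,
        Complex.exp (-(inner ℝ (B 0) y : ℝ) + Complex.I * (inner ℝ (B 1) y : ℝ)) =
      ∫ q : ℂ, Complex.exp (-(Real.cot θ * ‖q‖ : ℝ) + Complex.I * q.re) := by
  have hB0 : ‖B 0‖ = 1 := B.orthonormal.1 0
  have hθπ : θ ≤ Real.pi := by linarith [Real.pi_pos]
  have hmeas : MeasurableSet (cone 0 (B 0) θ) := (isOpen_cone hB0 hθ.le hθπ).measurableSet
  obtain ⟨e, he, hcoord⟩ := exists_measurePreserving_coord B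
  have hnorm : ∀ t q, ‖e (t, q)‖ = √(t ^ 2 + ‖q‖ ^ 2) := fun t q => by
    obtain ⟨h0, h1, h2⟩ := hcoord t q
    rw [← Real.sqrt_sq (norm_nonneg _), ← B.sum_sq_inner_right, Fin.sum_univ_three, h0, h1, h2,
      Complex.sq_norm, Complex.normSq_apply]
    ring_nf
  have hmem : ∀ t q, e (t, q) ∈ cone 0 (B 0) θ ↔ t ∈ Set.Ioi (Real.cot θ * ‖q‖) := fun t q => by
    rw [mem_cone_iff hB0 hθ.le hθπ, sub_zero, hnorm, (hcoord t q).1,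
      cos_mul_sqrt_lt_iff hθ hθ' (norm_nonneg q), Set.mem_Ioi]
  set F : R3 → ℂ := (cone 0 (B 0) θ).indicator fun y =>
    Complex.exp (-(inner ℝ (B 0) y : ℝ) + Complex.I * (inner ℝ (B 1) y : ℝ)) with hF
  have hfiber : ∀ t q, F (e (t, q)) = (Set.Ioi (Real.cot θ * ‖q‖)).indicator
      (fun t : ℝ => Complex.exp (-1 * t) * Complex.exp (Complex.I * q.re)) t := fun t q => by
    by_cases ht : t ∈ Set.Ioi (Real.cot θ * ‖q‖)
    · rw [hF, Set.indicator_of_mem ((hmem t q).2 ht), Set.indicator_of_mem ht, (hcoord t q).1,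
        (hcoord t q).2.1, Complex.exp_add, neg_one_mul]
    · rw [hF, Set.indicator_of_notMem (mt (hmem t q).1 ht), Set.indicator_of_notMem ht]
  have hint : Integrable (fun p => F (e p)) (volume.prod volume) :=
    (he.integrable_comp_emb e.measurableEmbedding).2
      ((integrable_indicator_iff hmeas).2 (integrableOn_cone_cexp hB0 hθ.le hθ'))
  rw [← integral_indicator hmeas, ← he.integral_comp e.measurableEmbedding,
    Measure.volume_eq_prod, integral_prod_symm _ hint]
  congr 1 with q
  simp only [hfiber]
  rw [integral_indicator measurableSet_Ioi, integral_mul_const,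
    integral_exp_mul_complex_Ioi (by simp), Complex.exp_add]
  simp

theorem exists_orthonormalBasis_of_inner_eq_zero {a b : R3} (ha : ‖a‖ = 1) (hb : ‖b‖ = 1)
    (hab : inner ℝ a b = 0) : ∃ B : OrthonormalBasis (Fin 3) ℝ R3, B 0 = a ∧ B 1 = b := by
  have hpair : Orthonormal ℝ (({0, 1} : Set (Fin 3)).domRestrict ![a, b, 0]) := by
    rw [orthonormal_iff_ite]
    rintro ⟨i, hi⟩ ⟨j, hj⟩
    rcases hi with rfl | rfl <;> rcases hj with rfl | rfl <;>
      simp [Set.domRestrict, ha, hb, hab, real_inner_comm, Subtype.ext_iff]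
  obtain ⟨B, hB⟩ := hpair.exists_orthonormalBasis_extension_of_card_eq (by simp)
  exact ⟨B, hB 0 (by simp), hB 1 (by simp)⟩

theorem integral_cone_cexp_ne_zero {a b : R3} (ha : ‖a‖ = 1) (hb : ‖b‖ = 1)
    (hab : inner ℝ a b = 0) {θ : ℝ} (hθ : 0 < θ) (hθ' : θ < Real.pi / 2) :
    ∫ y in cone 0 a θ, Complex.exp (-(inner ℝ a y : ℝ) + Complex.I * (inner ℝ b y : ℝ)) ≠ 0 := by
  have hcot : 0 < Real.cot θ := by
    rw [Real.cot_eq_cos_div_sin]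
    exact div_pos (Real.cos_pos_of_mem_Ioo ⟨by linarith, hθ'⟩)
      (Real.sin_pos_of_pos_of_lt_pi hθ (by linarith))
  obtain ⟨B, rfl, rfl⟩ := exists_orthonormalBasis_of_inner_eq_zero ha hb hab
  rw [integral_cone_cexp B hθ hθ', integral_cexp_neg_mul_norm_add_I_mul_re hcot]
  exact integral_one_div_sub_I_mul_cos_sq_ne_zero hcot

/-! ### Weak curls and tangential traces -/

/-- The bilinear product `dotC` on `ℂ³` as a bundled bilinear map. -/
noncomputable def dotCL : C3 →L[ℂ] C3 →L[ℂ] ℂ :=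
  LinearMap.toContinuousBilinearMap <| (dotProductBilin ℂ ℂ).compl₁₂
    (WithLp.linearEquiv 2 ℂ (Fin 3 → ℂ)).toLinearMap
    (WithLp.linearEquiv 2 ℂ (Fin 3 → ℂ)).toLinearMap

/-- The bilinear cross product on `ℂ³`. -/
noncomputable def crossC : C3 →L[ℂ] C3 →L[ℂ] C3 :=
  LinearMap.toContinuousBilinearMap <| (crossProduct.compl₁₂
    (WithLp.linearEquiv 2 ℂ (Fin 3 → ℂ)).toLinearMap
    (WithLp.linearEquiv 2 ℂ (Fin 3 → ℂ)).toLinearMap).compr₂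
    (WithLp.linearEquiv 2 ℂ (Fin 3 → ℂ)).symm.toLinearMap

theorem dotCL_apply (u v : C3) : dotCL u v = dotC u v := rfl

theorem dotCL_comm (u v : C3) : dotCL u v = dotCL v u :=
  dotProduct_comm u.ofLp v.ofLp

theorem crossC_self (u : C3) : crossC u u = 0 :=
  congrArg (WithLp.toLp 2) (cross_self u.ofLp)

theorem crossC_neg_swap (u v : C3) : -crossC u v = crossC v u :=
  congrArg (WithLp.toLp 2) (cross_anticomm u.ofLp v.ofLp)

theorem dotCL_crossC_eq_neg (u v w : C3) : dotCL u (crossC v w) = -dotCL (crossC v u) w := by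
  rw [← crossC_neg_swap u v, map_neg, neg_apply, neg_neg, dotCL_comm _ w]
  exact (triple_product_permutation u.ofLp v.ofLp w.ofLp).trans
    (triple_product_permutation v.ofLp w.ofLp u.ofLp)

theorem crossC_crossC (u v w : C3) :
    crossC u (crossC v w) = dotCL u w • v - dotCL u v • w := by
  rw [dotCL_comm u v]
  exact congrArg (WithLp.toLp 2) (cross_cross_eq_smul_sub_smul' u.ofLp v.ofLp w.ofLp)

/-- The vector of `ℂ³` representing an `ℝ`-linear functional `ℝ³ → ℂ` by means of the bilinear
product; the gradient of `s` at `x` is `dualVec (fderiv ℝ s x)`. -/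
noncomputable def dualVec : (R3 →L[ℝ] ℂ) →ₗ[ℂ] C3 where
  toFun ℓ := WithLp.toLp 2 fun j => ℓ (EuclideanSpace.single j 1)
  map_add' _ _ := rfl
  map_smul' _ _ := rfl

theorem dualVec_apply (ℓ : R3 →L[ℝ] ℂ) (j : Fin 3) :
    dualVec ℓ j = ℓ (EuclideanSpace.single j 1) := rfl

theorem continuous_dualVec : Continuous dualVec :=
  (PiLp.continuous_toLp 2 _).comp (continuous_pi fun _ => by fun_prop)

/-- The inner product with a vector of `ℝ³` as a functional with complex values. -/
noncomputable def innerC : R3 →ₗ[ℝ] R3 →L[ℝ] ℂ where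
  toFun v := Complex.ofRealCLM ∘L innerSL ℝ v
  map_add' v w := by ext; simp
  map_smul' c v := by ext; simp

theorem innerC_apply (v y : R3) : innerC v y = (inner ℝ v y : ℝ) := rfl

theorem dualVec_innerC_apply (v : R3) (j : Fin 3) : dualVec (innerC v) j = v j := by
  simp [dualVec_apply, innerC_apply, EuclideanSpace.inner_single_right]

theorem dotCL_dualVec_innerC (v w : R3) :
    dotCL (dualVec (innerC v)) (dualVec (innerC w)) = (inner ℝ v w : ℝ) := by
  simp only [dotCL_apply, dotC, dualVec_innerC_apply, PiLp.inner_apply]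
  simp [mul_comm]

theorem eq_zero_of_forall_dotCL_dualVec_innerC (B : OrthonormalBasis (Fin 3) ℝ R3) {u : C3}
    (hu : ∀ i, dotCL u (dualVec (innerC (B i))) = 0) : u = 0 := by
  have hzero : ((dotCL u).toLinearMap ∘ₗ dualVec).restrictScalars ℝ ∘ₗ innerC = 0 :=
    B.toBasis.ext fun i => by simpa using hu i
  ext j
  have hj := LinearMap.congr_fun hzero (EuclideanSpace.single j 1)
  simpa [dotCL_apply, dotC, dualVec_innerC_apply, PiLp.single_apply, apply_ite Complex.ofReal]
    using hj

theorem curl_smul_const {s : R3 → ℂ} {x : R3} (hs : DifferentiableAt ℝ s x) (w : C3) :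
    curl (fun y => s y • w) x = crossC (dualVec (fderiv ℝ s x)) w := by
  have hpartial : ∀ j i, partialDeriv (fun y => s y • w) j i x =
      dualVec (fderiv ℝ s x) j * w i := fun j i => by
    simp [partialDeriv, fderiv_smul_const hs, dualVec_apply]
  simp only [curl, hpartial]
  exact congrArg (WithLp.toLp 2) (cross_apply _ _).symm

theorem curl_eq_zero_of_notMem_tsupport {φ : R3 → C3} {x : R3} (hx : x ∉ tsupport φ) :
    curl φ x = 0 := by
  ext j
  fin_cases j <;> simp [curl, partialDeriv, fderiv_of_notMem_tsupport ℝ hx]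

theorem IsTestField.continuous_curl {φ : R3 → C3} (hφ : IsTestField φ) : Continuous (curl φ) := by
  have hderiv : Continuous (fderiv ℝ φ) := hφ.1.continuous_fderiv (by simp)
  unfold curl partialDeriv
  refine (PiLp.continuous_toLp 2 _).comp (continuous_pi fun j => ?_)
  fin_cases j <;> simp only [Fin.zero_eta, Fin.mk_one, Fin.reduceFinMk, Matrix.cons_val] <;>
    fun_prop

theorem IsTestField.hasCompactSupport_curl {φ : R3 → C3} (hφ : IsTestField φ) :
    HasCompactSupport (curl φ) :=
  hφ.2.mono' (Function.support_subset_iff'.2 fun _ => curl_eq_zero_of_notMem_tsupport)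

theorem isTestField_smul_const {s : R3 → ℂ} (hs : ContDiff ℝ ((⊤ : ℕ∞) : WithTop ℕ∞) s)
    (hs' : HasCompactSupport s) (w : C3) : IsTestField fun x => s x • w :=
  ⟨hs.smul contDiff_const, hs'.smul_right⟩

theorem integrable_bilin_of_hasCompactSupport {F G H : Type*} [NormedAddCommGroup F]
    [NormedSpace ℂ F] [NormedAddCommGroup G] [NormedSpace ℂ G] [NormedAddCommGroup H]
    [NormedSpace ℂ H] {μ : Measure R3} (B : F →L[ℂ] G →L[ℂ] H) {u : R3 → F} (hu : Integrable u μ)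
    {ψ : R3 → G} (hψ : Continuous ψ) (hψ' : HasCompactSupport ψ) :
    Integrable (fun x => B (u x) (ψ x)) μ := by
  obtain ⟨M, hM⟩ := hψ.bounded_above_of_compact_support hψ'
  exact B.integrable_of_bilin_of_bdd_right M hu hψ.aestronglyMeasurable (ae_of_all _ hM)

theorem IsTestField.integrable_dotC {φ : R3 → C3} (hφ : IsTestField φ) {μ : Measure R3}
    {u : R3 → C3} (hu : Integrable u μ) : Integrable (fun x => dotC (u x) (φ x)) μ := by
  simpa only [dotCL_apply] using
    integrable_bilin_of_hasCompactSupport dotCL hu hφ.1.continuous hφ.2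

theorem IsTestField.integrable_dotC_curl {φ : R3 → C3} (hφ : IsTestField φ) {μ : Measure R3}
    {u : R3 → C3} (hu : Integrable u μ) : Integrable (fun x => dotC (u x) (curl φ x)) μ := by
  simpa only [dotCL_apply] using
    integrable_bilin_of_hasCompactSupport dotCL hu hφ.continuous_curl hφ.hasCompactSupport_curl

theorem dotC_sub_left (u v w : C3) : dotC (u - v) w = dotC u w - dotC v w := by
  simp only [← dotCL_apply, map_sub, sub_apply]

theorem dotC_zero_right (u : C3) : dotC u 0 = 0 :=
  map_zero (dotCL u)

theorem IsWeakCurl.mono {Ω K : Set R3} (hΩ : MeasurableSet Ω) (hK : K ⊆ Ω) {u c : R3 → C3}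
    (h : IsWeakCurl Ω u c) : IsWeakCurl K u c := fun φ hφ hsupp => by
  rw [← setIntegral_eq_of_subset_of_forall_sdiff_eq_zero hΩ hK fun x hx => by
      rw [image_eq_zero_of_notMem_tsupport fun hxφ => hx.2 (hsupp hxφ), dotC_zero_right],
    ← setIntegral_eq_of_subset_of_forall_sdiff_eq_zero hΩ hK fun x hx => by
      rw [curl_eq_zero_of_notMem_tsupport fun hxφ => hx.2 (hsupp hxφ), dotC_zero_right]]
  exact h φ hφ (hsupp.trans hK)

theorem tangentialTrace_inter {Ω B : Set R3} (hΩ : MeasurableSet Ω) {φ : R3 → C3}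
    (hφ : tsupport φ ⊆ B) (u c : R3 → C3) :
    tangentialTrace (Ω ∩ B) u c φ = tangentialTrace Ω u c φ := by
  refine (setIntegral_eq_of_subset_of_forall_sdiff_eq_zero hΩ Set.inter_subset_left
    fun x hx => ?_).symm
  have hxφ : x ∉ tsupport φ := fun hxφ => hx.2 ⟨hx.1, hφ hxφ⟩
  rw [image_eq_zero_of_notMem_tsupport hxφ, curl_eq_zero_of_notMem_tsupport hxφ,
    dotC_zero_right, dotC_zero_right, sub_zero]

theorem tangentialTrace_congr_curl {Ω : Set R3} {u c c' : R3 → C3}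
    (hc : c =ᵐ[volume.restrict Ω] c') (φ : R3 → C3) :
    tangentialTrace Ω u c φ = tangentialTrace Ω u c' φ :=
  integral_congr_ae (hc.mono fun x hx => by simp only [hx])

theorem tangentialTrace_sub {Ω : Set R3} {u v cu cv φ : R3 → C3} (hφ : IsTestField φ)
    (hu : IntegrableOn u Ω) (hv : IntegrableOn v Ω) (hcu : IntegrableOn cu Ω)
    (hcv : IntegrableOn cv Ω) :
    tangentialTrace Ω (u - v) (cu - cv) φ =
      tangentialTrace Ω u cu φ - tangentialTrace Ω v cv φ := by
  have hint : ∀ {w c : R3 → C3}, IntegrableOn w Ω → IntegrableOn c Ω →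
      IntegrableOn (fun x => dotC (c x) (φ x) - dotC (w x) (curl φ x)) Ω := fun hw hc =>
    (hφ.integrable_dotC hc).sub (hφ.integrable_dotC_curl hw)
  unfold tangentialTrace
  rw [← integral_sub (hint hu hcu) (hint hv hcv)]
  refine integral_congr_ae (ae_of_all _ fun x => ?_)
  simp only [Pi.sub_apply, dotC_sub_left]
  ring

theorem IsWeakCurl.ae_eq {Ω : Set R3} (hΩ : IsOpen Ω) {u c c' : R3 → C3}
    (hc : IntegrableOn c Ω) (hc' : IntegrableOn c' Ω) (h : IsWeakCurl Ω u c)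
    (h' : IsWeakCurl Ω u c') : c =ᵐ[volume.restrict Ω] c' := by
  have hcomp : ∀ i : Fin 3, ∀ᵐ x ∂(volume.restrict Ω), x ∈ Ω → (c x - c' x) i = 0 := fun i => by
    have hint : IntegrableOn (fun x => (c x - c' x) i) Ω :=
      (EuclideanSpace.proj i : C3 →L[ℂ] ℂ).integrable_comp (hc.sub hc')
    refine hΩ.ae_eq_zero_of_integral_contDiff_smul_eq_zero
      (hint.locallyIntegrable.locallyIntegrableOn _) fun g hg hgc hgs => ?_
    have hsupp : tsupport (fun x => (g x : ℂ) • (EuclideanSpace.single i 1 : C3)) ⊆ tsupport g :=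
      closure_mono fun x hx hgx => hx (by simp [hgx])
    have htest := isTestField_smul_const (Complex.ofRealCLM.contDiff.comp hg)
      (hgc.comp_left Complex.ofReal_zero) (EuclideanSpace.single i 1)
    have heq := (h _ htest (hsupp.trans hgs)).trans (h' _ htest (hsupp.trans hgs)).symm
    rw [← sub_eq_zero,
      ← integral_sub (htest.integrable_dotC hc) (htest.integrable_dotC hc')] at heq
    simpa [dotC, PiLp.single_apply, mul_sub, mul_comm] using heq
  filter_upwards [ae_all_iff.2 hcomp, ae_restrict_mem hΩ.measurableSet] with x hx hxΩ
  rw [← sub_eq_zero]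
  ext i
  exact hx i hxΩ

/-- The field `u` has the weak curl `c` in the open set `K`, and its tangential trace vanishes on
the part of `∂K` inside the open set `B`. As for `TangentialTraceEqOn`, both conditions are
expressed by integration by parts, against test fields supported in `B`. -/
def HasZeroTraceCurl (K B : Set R3) (u c : R3 → C3) : Prop :=
  ∀ φ : R3 → C3, IsTestField φ → tsupport φ ⊆ B → tangentialTrace K u c φ = 0

theorem integrableOn_inter_of_memLp_two {Ω B : Set R3} (hB : volume B ≠ ⊤) {w : R3 → C3}
    (hw : MemLp w 2 (volume.restrict Ω)) : IntegrableOn w (Ω ∩ B) :=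
  have : IsFiniteMeasure (volume.restrict (Ω ∩ B)) :=
    isFiniteMeasure_restrict.2 (measure_ne_top_of_subset Set.inter_subset_right hB)
  (hw.mono_measure (Measure.restrict_mono_set _ Set.inter_subset_left)).integrable (by norm_num)

theorem TangentialTraceEqOn.hasZeroTraceCurl {Ω Γ B : Set R3} (hΩ : IsOpen Ω) (hB : IsOpen B)
    (hBvol : volume B ≠ ⊤) (hBΓ : B ∩ frontier Ω ⊆ Γ) {u v cu cv : R3 → C3}
    (htr : TangentialTraceEqOn Ω Γ u v) (hu : IsWeakCurl Ω u cu) (hv : IsWeakCurl Ω v cv)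
    (hcu : IntegrableOn cu (Ω ∩ B)) (hcv : IntegrableOn cv (Ω ∩ B)) :
    HasZeroTraceCurl (Ω ∩ B) B (u - v) (cu - cv) := fun φ hφ hsupp => by
  obtain ⟨cu', cv', hu', hv', heq⟩ := htr
  have hint : ∀ {w : R3 → C3}, MemLp w 2 (volume.restrict Ω) → IntegrableOn w (Ω ∩ B) :=
    integrableOn_inter_of_memLp_two hBvol
  have hae : ∀ {w c c' : R3 → C3}, IsWeakCurl Ω w c → IntegrableOn c (Ω ∩ B) → HasL2Curl Ω w c' →
      c =ᵐ[volume.restrict (Ω ∩ B)] c' := fun hw hc hw' =>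
    have hmono := Set.inter_subset_left (s := Ω) (t := B)
    IsWeakCurl.ae_eq (hΩ.inter hB) hc (hint hw'.memLp_curl) (hw.mono hΩ.measurableSet hmono)
      (hw'.isWeakCurl.mono hΩ.measurableSet hmono)
  rw [tangentialTrace_sub hφ (hint hu'.memLp) (hint hv'.memLp) hcu hcv,
    tangentialTrace_congr_curl (hae hu hcu hu'), tangentialTrace_congr_curl (hae hv hcv hv'),
    tangentialTrace_inter hΩ.measurableSet hsupp, tangentialTrace_inter hΩ.measurableSet hsupp,
    heq φ hφ ((Set.inter_subset_inter_left _ hsupp).trans hBΓ), sub_self]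

/-- The curl `χ c + ∇χ ∧ u` of the cut-off field `χ u`, where `c` is the curl of `u`. -/
noncomputable def cutoffCurl (χ : R3 → ℂ) (u c : R3 → C3) (x : R3) : C3 :=
  χ x • c x + crossC (dualVec (fderiv ℝ χ x)) (u x)

section Cutoff

variable {u c : R3 → C3} {χ : R3 → ℂ}

theorem integrable_cutoffCurl {μ : Measure R3} (hu : Integrable u μ) (hc : Integrable c μ)
    (hχ : ContDiff ℝ ((⊤ : ℕ∞) : WithTop ℕ∞) χ) (hχ' : HasCompactSupport χ) :
    Integrable (cutoffCurl χ u c) μ := by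
  have hgrad : Continuous fun x => dualVec (fderiv ℝ χ x) :=
    continuous_dualVec.comp (hχ.continuous_fderiv (by simp))
  refine (integrable_bilin_of_hasCompactSupport (ContinuousLinearMap.lsmul ℂ ℂ).flip hc
    hχ.continuous hχ').add (integrable_bilin_of_hasCompactSupport crossC.flip hu hgrad ?_)
  exact (hχ'.fderiv ℝ).comp_left (map_zero dualVec)

theorem integrable_cexp_smul_smul {μ : Measure R3} (hu : Integrable u μ) (hχ : Continuous χ)
    (hχ' : HasCompactSupport χ) (ℓ : R3 →L[ℝ] ℂ) (x₀ : R3) :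
    Integrable (fun x => Complex.exp (ℓ (x - x₀)) • χ x • u x) μ := by
  have hexp : Continuous fun x => Complex.exp (ℓ (x - x₀)) := by fun_prop
  refine (integrable_bilin_of_hasCompactSupport (ContinuousLinearMap.lsmul ℂ ℂ).flip hu
    (hexp.mul hχ) hχ'.mul_left).congr (ae_of_all _ fun x => ?_)
  exact mul_smul (Complex.exp (ℓ (x - x₀))) (χ x) (u x)

theorem cexp_smul_cutoffCurl {x : R3} (hχ : DifferentiableAt ℝ χ x) (ℓ : R3 →L[ℝ] ℂ) (x₀ : R3) :
    Complex.exp (ℓ (x - x₀)) • cutoffCurl χ u c x =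
      cutoffCurl (fun y => χ y * Complex.exp (ℓ (y - x₀))) u c x -
        crossC (dualVec ℓ) (Complex.exp (ℓ (x - x₀)) • χ x • u x) := by
  have hexp : HasFDerivAt (fun y => Complex.exp (ℓ (y - x₀))) (Complex.exp (ℓ (x - x₀)) • ℓ) x :=
    (ℓ.hasFDerivAt.comp x ((hasFDerivAt_id x).sub_const x₀)).cexp
  simp only [cutoffCurl, fderiv_fun_mul hχ hexp.differentiableAt, hexp.fderiv, map_add, map_smul,
    add_apply, smul_apply]
  module

theorem contDiff_mul_cexp (hχ : ContDiff ℝ ((⊤ : ℕ∞) : WithTop ℕ∞) χ) (ℓ : R3 →L[ℝ] ℂ)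
    (x₀ : R3) : ContDiff ℝ ((⊤ : ℕ∞) : WithTop ℕ∞) fun x => χ x * Complex.exp (ℓ (x - x₀)) :=
  hχ.mul (ℓ.contDiff.comp (contDiff_id.sub contDiff_const)).cexp

theorem integrable_cexp_smul_cutoffCurl {μ : Measure R3} (hu : Integrable u μ)
    (hc : Integrable c μ) (hχ : ContDiff ℝ ((⊤ : ℕ∞) : WithTop ℕ∞) χ)
    (hχ' : HasCompactSupport χ) (ℓ : R3 →L[ℝ] ℂ) (x₀ : R3) :
    Integrable (fun x => Complex.exp (ℓ (x - x₀)) • cutoffCurl χ u c x) μ := by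
  simp only [cexp_smul_cutoffCurl (hχ.differentiable (by simp) _) ℓ x₀]
  exact (integrable_cutoffCurl hu hc (contDiff_mul_cexp hχ ℓ x₀) hχ'.mul_right).sub
    ((crossC (dualVec ℓ)).integrable_comp (integrable_cexp_smul_smul hu hχ.continuous hχ' ℓ x₀))

variable {K B : Set R3}

theorem HasZeroTraceCurl.integral_cutoffCurl (h : HasZeroTraceCurl K B u c)
    (hu : IntegrableOn u K) (hc : IntegrableOn c K) (hχ : ContDiff ℝ ((⊤ : ℕ∞) : WithTop ℕ∞) χ)
    (hχ' : HasCompactSupport χ) (hχB : tsupport χ ⊆ B) : ∫ x in K, cutoffCurl χ u c x = 0 := by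
  have htest : ∀ p x, dotC (c x) (χ x • p) - dotC (u x) (curl (fun y => χ y • p) x) =
      dotCL p (cutoffCurl χ u c x) := fun p x => by
    rw [curl_smul_const (hχ.differentiable (by simp) x), ← dotCL_apply, ← dotCL_apply, cutoffCurl,
      dotCL_crossC_eq_neg, sub_neg_eq_add, map_add, map_smul, map_smul, dotCL_comm p, dotCL_comm p]
  have hdot : ∀ p, dotCL p (∫ x in K, cutoffCurl χ u c x) = 0 := fun p => by
    rw [← (dotCL p).integral_comp_comm (integrable_cutoffCurl hu hc hχ hχ')]
    simp only [← htest]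
    exact h _ (isTestField_smul_const hχ hχ' p)
      ((closure_mono (Function.support_smul_subset_left _ _)).trans hχB)
  ext j
  simpa [dotCL_apply, dotC, PiLp.single_apply] using hdot (EuclideanSpace.single j 1)

theorem HasZeroTraceCurl.integral_cexp_smul_cutoffCurl (h : HasZeroTraceCurl K B u c)
    (hu : IntegrableOn u K) (hc : IntegrableOn c K) (hχ : ContDiff ℝ ((⊤ : ℕ∞) : WithTop ℕ∞) χ)
    (hχ' : HasCompactSupport χ) (hχB : tsupport χ ⊆ B) (ℓ : R3 →L[ℝ] ℂ) (x₀ : R3) :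
    ∫ x in K, Complex.exp (ℓ (x - x₀)) • cutoffCurl χ u c x =
      -crossC (dualVec ℓ) (∫ x in K, Complex.exp (ℓ (x - x₀)) • χ x • u x) := by
  have hmul := contDiff_mul_cexp hχ ℓ x₀
  have hint := integrable_cexp_smul_smul hu hχ.continuous hχ' ℓ x₀
  simp only [cexp_smul_cutoffCurl (hχ.differentiable (by simp) _) ℓ x₀]
  rw [integral_sub (integrable_cutoffCurl hu hc hmul hχ'.mul_right)
    ((crossC (dualVec ℓ)).integrable_comp hint), h.integral_cutoffCurl hu hc hmul hχ'.mul_right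
    (tsupport_mul_subset_left.trans hχB), zero_sub, (crossC (dualVec ℓ)).integral_comp_comm hint]

theorem HasZeroTraceCurl.dotCL_integral_cexp_smul_cutoffCurl {v f : R3 → C3} {A : ℂ}
    (h : HasZeroTraceCurl K B u (f + A • v)) (hu : IntegrableOn u K) (hv : IntegrableOn v K)
    (hf : IntegrableOn f K) (hχ : ContDiff ℝ ((⊤ : ℕ∞) : WithTop ℕ∞) χ)
    (hχ' : HasCompactSupport χ) (hχB : tsupport χ ⊆ B) (ℓ : R3 →L[ℝ] ℂ) (x₀ : R3) (p : C3) :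
    dotCL p (∫ x in K, Complex.exp (ℓ (x - x₀)) • cutoffCurl χ u f x) =
      dotCL (crossC (dualVec ℓ) p) (∫ x in K, Complex.exp (ℓ (x - x₀)) • χ x • u x) -
        A * dotCL p (∫ x in K, Complex.exp (ℓ (x - x₀)) • χ x • v x) := by
  have hsplit : ∀ x, Complex.exp (ℓ (x - x₀)) • cutoffCurl χ u (f + A • v) x =
      Complex.exp (ℓ (x - x₀)) • cutoffCurl χ u f x +
        A • Complex.exp (ℓ (x - x₀)) • χ x • v x := fun x => by
    simp only [cutoffCurl, Pi.add_apply, Pi.smul_apply]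
    module
  have hv' : IntegrableOn (fun x => A • Complex.exp (ℓ (x - x₀)) • χ x • v x) K :=
    (integrable_cexp_smul_smul hv hχ.continuous hχ' ℓ x₀).smul A
  have heq := h.integral_cexp_smul_cutoffCurl hu (hf.add (hv.smul A)) hχ hχ' hχB ℓ x₀
  simp only [hsplit] at heq
  rw [integral_add (integrable_cexp_smul_cutoffCurl hu hf hχ hχ' ℓ x₀) hv', integral_smul,
    ← eq_sub_iff_add_eq] at heq
  rw [heq, map_sub, map_neg, dotCL_crossC_eq_neg, neg_neg, map_smul, smul_eq_mul]

/-- If `ζ` is the wave vector of `ℓ`, then `p e^ℓ` and `q e^ℓ` solve the adjoint system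
`ζ ∧ p = D q`, `ζ ∧ q = A p`, and therefore only the sources `f` and `g` survive. -/
theorem HasZeroTraceCurl.dotCL_add_dotCL_eq_zero {v f g : R3 → C3} {A D : ℂ}
    (hu : HasZeroTraceCurl K B u (f + A • v)) (hv : HasZeroTraceCurl K B v (g + D • u))
    (hui : IntegrableOn u K) (hvi : IntegrableOn v K) (hf : IntegrableOn f K)
    (hg : IntegrableOn g K) (hχ : ContDiff ℝ ((⊤ : ℕ∞) : WithTop ℕ∞) χ)
    (hχ' : HasCompactSupport χ) (hχB : tsupport χ ⊆ B) {ℓ : R3 →L[ℝ] ℂ} (x₀ : R3) {p q : C3}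
    (hp : crossC (dualVec ℓ) p = D • q) (hq : crossC (dualVec ℓ) q = A • p) :
    dotCL p (∫ x in K, Complex.exp (ℓ (x - x₀)) • cutoffCurl χ u f x) +
      dotCL q (∫ x in K, Complex.exp (ℓ (x - x₀)) • cutoffCurl χ v g x) = 0 := by
  rw [hu.dotCL_integral_cexp_smul_cutoffCurl hui hvi hf hχ hχ' hχB,
    hv.dotCL_integral_cexp_smul_cutoffCurl hvi hui hg hχ hχ' hχB, hp, hq]
  simp only [map_smul, smul_apply, smul_eq_mul]
  ring

end Cutoff

/-! ### The Maxwell system at a conical corner -/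

theorem HasEssValueAt.cutoffCurl {K : Set R3} {x₀ : R3} {f u : R3 → C3} {f₀ : C3}
    (hf : HasEssValueAt K f x₀ f₀) {χ : R3 → ℂ} (hχ : χ =ᶠ[𝓝 x₀] 1) :
    HasEssValueAt K (cutoffCurl χ u f) x₀ f₀ := by
  refine Tendsto.congr' ?_ hf
  filter_upwards [hχ.filter_mono inf_le_right, (hχ.fderiv (𝕜 := ℝ)).filter_mono inf_le_right]
    with x hx hx'
  simp [_root_.cutoffCurl, hx, hx']

theorem exists_cutoff (x₀ : R3) {r : ℝ} (hr : 0 < r) :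
    ∃ χ : R3 → ℂ, ContDiff ℝ ((⊤ : ℕ∞) : WithTop ℕ∞) χ ∧ HasCompactSupport χ ∧
      tsupport χ ⊆ Metric.ball x₀ r ∧ χ =ᶠ[𝓝 x₀] 1 := by
  let χ : ContDiffBump x₀ := ⟨r / 4, r / 2, by positivity, by linarith⟩
  refine ⟨fun x => χ x, Complex.ofRealCLM.contDiff.comp χ.contDiff,
    χ.hasCompactSupport.comp_left Complex.ofReal_zero, ?_, ?_⟩
  · refine (closure_mono (Function.support_comp_subset Complex.ofReal_zero χ)).trans ?_
    exact χ.tsupport_eq.subset.trans (Metric.closedBall_subset_ball (half_lt_self hr))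
  · exact χ.eventuallyEq_one.mono fun x hx => by simp [hx]

/-- The phase `-a · y + i σ b · y` of an exponential that decays along the axis `a` and, for
`σ` near `1`, oscillates in the direction `b`. -/
noncomputable def conePhase (a b : R3) (σ : ℂ) : R3 →L[ℝ] ℂ :=
  -innerC a + (Complex.I * σ) • innerC b

theorem dualVec_conePhase (a b : R3) (σ : ℂ) :
    dualVec (conePhase a b σ) = -dualVec (innerC a) + (Complex.I * σ) • dualVec (innerC b) := by
  rw [conePhase, map_add, map_neg, map_smul]

theorem re_conePhase_one_le {a b y : R3} {θ : ℝ} (ha : ‖a‖ = 1) (hθ : 0 ≤ θ) (hθπ : θ ≤ Real.pi)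
    (hy : y ∈ cone 0 a θ) : (conePhase a b 1 y).re ≤ -(Real.cos θ * ‖y‖) := by
  have hlt := (mem_cone_iff ha hθ hθπ).1 hy
  rw [sub_zero] at hlt
  simpa [conePhase, innerC_apply] using hlt.le

theorem tendsto_pow_smul_setIntegral_truncatedCone {x₀ a b : R3} {θ r : ℝ} (ha : ‖a‖ = 1)
    (hθ : 0 < θ) (hθ' : θ < Real.pi / 2) (hr : 0 < r) {f : R3 → C3} {f₀ : C3}
    (hf : IntegrableOn f (truncatedCone x₀ a θ r))
    (hf₀ : HasEssValueAt (truncatedCone x₀ a θ r) f x₀ f₀) {σ : ℝ → ℂ}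
    (hσ : Tendsto σ atTop (𝓝 1)) :
    Tendsto (fun τ : ℝ => τ ^ 3 • ∫ x in truncatedCone x₀ a θ r,
        Complex.exp (((τ : ℂ) • conePhase a b (σ τ)) (x - x₀)) • f x) atTop
      (𝓝 ((∫ y in cone 0 a θ, Complex.exp (conePhase a b 1 y)) • f₀)) := by
  have hθπ : θ ≤ Real.pi := by linarith [Real.pi_pos]
  have hphase : Tendsto (fun τ : ℝ => τ⁻¹ • (τ : ℂ) • conePhase a b (σ τ)) atTop
      (𝓝 (conePhase a b 1)) := by
    refine (tendsto_const_nhds.add ((hσ.const_mul Complex.I).smul_const (innerC b))).congr' ?_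
    filter_upwards [eventually_ne_atTop 0] with τ hτ
    ext y
    simp [conePhase, hτ]
  rw [truncatedCone_eq_preimage] at hf ⊢
  rw [HasEssValueAt, truncatedCone_eq_preimage] at hf₀
  simpa only [finrank_euclideanSpace_fin] using tendsto_pow_smul_setIntegral_cexp_smul volume
    (isOpen_cone ha hθ.le hθπ).measurableSet (fun t ht y hy => smul_mem_cone ht hy)
    (Real.cos_pos_of_mem_Ioo ⟨by linarith, hθ'⟩) hphase
    (fun y hy => re_conePhase_one_le ha hθ.le hθπ hy) hr hf hf₀

/-- The choice of `σ` makes `(-α + i σ β) · (-α + i σ β) = -A D / τ²`, the dispersion relation of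
the system. -/
theorem crossC_wave_polarization {α β : C3} (hα : dotCL α α = 1) (hβ : dotCL β β = 1)
    (hαβ : dotCL α β = 0) {τ : ℂ} (hτ : τ ≠ 0) {A D σ : ℂ} (hσ : σ ^ 2 = 1 + A * D / τ ^ 2) :
    crossC (τ • (-α + (Complex.I * σ) • β)) ((D / τ) • crossC α β) =
        D • (β + (Complex.I * σ) • α) ∧
      crossC (τ • (-α + (Complex.I * σ) • β)) (β + (Complex.I * σ) • α) =
        A • (D / τ) • crossC α β := by
  have hβα : dotCL β α = 0 := by rw [dotCL_comm, hαβ]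
  have hτσ : τ * σ ^ 2 = τ + A * D / τ := by rw [hσ]; field_simp
  constructor
  · simp only [map_add, map_smul, map_neg, add_apply, smul_apply, neg_apply, crossC_crossC, hα, hβ,
      hαβ, hβα]
    match_scalars <;> field_simp <;> ring
  · simp only [map_add, map_smul, map_neg, add_apply, smul_apply, neg_apply, crossC_self,
      ← crossC_neg_swap α β]
    match_scalars
    linear_combination hτσ - τ * σ ^ 2 * Complex.I_sq

theorem HasZeroTraceCurl.dotCL_conePhase_add_eq_zero {K B : Set R3} {u v f g : R3 → C3} {A D : ℂ}
    (hu : HasZeroTraceCurl K B u (f + A • v)) (hv : HasZeroTraceCurl K B v (g + D • u))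
    (hui : IntegrableOn u K) (hvi : IntegrableOn v K) (hf : IntegrableOn f K)
    (hg : IntegrableOn g K) {χ : R3 → ℂ} (hχ : ContDiff ℝ ((⊤ : ℕ∞) : WithTop ℕ∞) χ)
    (hχ' : HasCompactSupport χ) (hχB : tsupport χ ⊆ B) {x₀ a b : R3} (ha : ‖a‖ = 1) (hb : ‖b‖ = 1)
    (hab : inner ℝ a b = 0) {τ σ : ℂ} (hτ : τ ≠ 0) (hσ : σ ^ 2 = 1 + A * D / τ ^ 2) :
    dotCL ((D / τ) • crossC (dualVec (innerC a)) (dualVec (innerC b)))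
        (∫ x in K, Complex.exp ((τ • conePhase a b σ) (x - x₀)) • cutoffCurl χ u f x) +
      dotCL (dualVec (innerC b) + (Complex.I * σ) • dualVec (innerC a))
        (∫ x in K, Complex.exp ((τ • conePhase a b σ) (x - x₀)) • cutoffCurl χ v g x) = 0 := by
  obtain ⟨hp, hq⟩ := crossC_wave_polarization (α := dualVec (innerC a)) (β := dualVec (innerC b))
    (by simp [dotCL_dualVec_innerC, ha]) (by simp [dotCL_dualVec_innerC, hb])
    (by simp [dotCL_dualVec_innerC, hab]) hτ hσ
  rw [← dualVec_conePhase, ← map_smul] at hp hq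
  exact hu.dotCL_add_dotCL_eq_zero hv hui hvi hf hg hχ hχ' hχB x₀ hp hq

theorem tendsto_div_ofReal_atTop (κ : ℂ) :
    Tendsto (fun τ : ℝ => κ / (τ : ℂ)) atTop (𝓝 0) := by
  have hinv : Tendsto (fun τ : ℝ => ((τ⁻¹ : ℝ) : ℂ)) atTop (𝓝 0) :=
    (Complex.continuous_ofReal.tendsto 0).comp tendsto_inv_atTop_zero
  simpa [div_eq_mul_inv] using hinv.const_mul κ

theorem exists_tendsto_sq_eq_one_add_div (κ : ℂ) :
    ∃ σ : ℝ → ℂ, Tendsto σ atTop (𝓝 1) ∧ ∀ τ : ℝ, σ τ ^ 2 = 1 + κ / (τ : ℂ) ^ 2 := by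
  refine ⟨fun τ => (1 + κ / (τ : ℂ) ^ 2) ^ ((2 : ℕ) : ℂ)⁻¹, ?_,
    fun τ => Complex.cpow_nat_inv_pow _ two_ne_zero⟩
  have hdiv : Tendsto (fun τ : ℝ => 1 + κ / (τ : ℂ) ^ 2) atTop (𝓝 1) := by
    simpa [sq, div_eq_mul_inv, mul_assoc] using
      ((tendsto_div_ofReal_atTop κ).mul (tendsto_div_ofReal_atTop 1)).const_add 1
  simpa only [Complex.one_cpow] using
    hdiv.cpow (tendsto_const_nhds (x := ((2 : ℕ) : ℂ)⁻¹)) Complex.one_mem_slitPlane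

section ConicalCorner

variable {x₀ a : R3} {θ r : ℝ} {u v f g : R3 → C3} {A D : ℂ} {f₀ g₀ : C3}

theorem HasZeroTraceCurl.dotCL_apex_eq_zero
    (hu : HasZeroTraceCurl (truncatedCone x₀ a θ r) (Metric.ball x₀ r) u (f + A • v))
    (hv : HasZeroTraceCurl (truncatedCone x₀ a θ r) (Metric.ball x₀ r) v (g + D • u))
    (hui : IntegrableOn u (truncatedCone x₀ a θ r)) (hvi : IntegrableOn v (truncatedCone x₀ a θ r))
    (hfi : IntegrableOn f (truncatedCone x₀ a θ r)) (hgi : IntegrableOn g (truncatedCone x₀ a θ r))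
    (hf₀ : HasEssValueAt (truncatedCone x₀ a θ r) f x₀ f₀)
    (hg₀ : HasEssValueAt (truncatedCone x₀ a θ r) g x₀ g₀)
    (ha : ‖a‖ = 1) (hθ : 0 < θ) (hθ' : θ < Real.pi / 2) (hr : 0 < r) {b : R3} (hb : ‖b‖ = 1)
    (hab : inner ℝ a b = 0) :
    dotCL (dualVec (innerC b) + Complex.I • dualVec (innerC a)) g₀ = 0 := by
  obtain ⟨χ, hχ, hχ', hχr, hχ1⟩ := exists_cutoff x₀ hr
  obtain ⟨σ, hσ, hσ2⟩ := exists_tendsto_sq_eq_one_add_div (A * D)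
  set α := dualVec (innerC a)
  set β := dualVec (innerC b)
  set J : ℂ := ∫ y in cone 0 a θ, Complex.exp (conePhase a b 1 y)
  have hJ : J ≠ 0 := by
    simpa [J, conePhase, innerC_apply] using integral_cone_cexp_ne_zero ha hb hab hθ hθ'
  let F (w h : R3 → C3) (τ : ℝ) : C3 := τ ^ 3 • ∫ x in truncatedCone x₀ a θ r,
    Complex.exp (((τ : ℂ) • conePhase a b (σ τ)) (x - x₀)) • cutoffCurl χ w h x
  have hlim : ∀ {w h h₀}, IntegrableOn w (truncatedCone x₀ a θ r) →
      IntegrableOn h (truncatedCone x₀ a θ r) → HasEssValueAt (truncatedCone x₀ a θ r) h x₀ h₀ →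
      Tendsto (F w h) atTop (𝓝 (J • h₀)) := fun hw hh hh₀ =>
    tendsto_pow_smul_setIntegral_truncatedCone ha hθ hθ' hr
      (integrable_cutoffCurl hw hh hχ hχ') (hh₀.cutoffCurl hχ1) hσ
  let p (τ : ℝ) : C3 := (D / τ) • crossC α β
  let q (τ : ℝ) : C3 := β + (Complex.I * σ τ) • α
  have hp : Tendsto p atTop (𝓝 0) := by
    simpa using (tendsto_div_ofReal_atTop D).smul_const (crossC α β)
  have hq : Tendsto q atTop (𝓝 (β + Complex.I • α)) := by
    simpa using ((hσ.const_mul Complex.I).smul_const α).const_add β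
  have hsum : ∀ᶠ τ in atTop, dotCL (p τ) (F u f τ) + dotCL (q τ) (F v g τ) = 0 := by
    filter_upwards [eventually_ne_atTop 0] with τ hτ
    simp only [F, ContinuousLinearMap.map_smul_of_tower, ← smul_add]
    rw [hu.dotCL_conePhase_add_eq_zero hv hui hvi hfi hgi hχ hχ' hχr ha hb hab
      (Complex.ofReal_ne_zero.2 hτ) (hσ2 τ), smul_zero]
  have hzero : dotCL (β + Complex.I • α) (J • g₀) = 0 := by
    have hlimsum := ((dotCL.continuous₂.tendsto _).comp (hp.prodMk_nhds (hlim hui hfi hf₀))).add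
      ((dotCL.continuous₂.tendsto _).comp (hq.prodMk_nhds (hlim hvi hgi hg₀)))
    simpa using tendsto_nhds_unique_of_eventuallyEq hlimsum tendsto_const_nhds hsum
  simpa [hJ] using hzero

theorem exists_orthonormalBasis_of_norm_eq_one (ha : ‖a‖ = 1) :
    ∃ B : OrthonormalBasis (Fin 3) ℝ R3, B 0 = a := by
  have hsingle : Orthonormal ℝ (({0} : Set (Fin 3)).domRestrict fun _ => a) := by
    rw [orthonormal_subsingleton_iff]
    exact fun _ => ha
  obtain ⟨B, hB⟩ := hsingle.exists_orthonormalBasis_extension_of_card_eq (by simp)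
  exact ⟨B, hB 0 rfl⟩

theorem HasZeroTraceCurl.apex_eq_zero
    (hu : HasZeroTraceCurl (truncatedCone x₀ a θ r) (Metric.ball x₀ r) u (f + A • v))
    (hv : HasZeroTraceCurl (truncatedCone x₀ a θ r) (Metric.ball x₀ r) v (g + D • u))
    (hui : IntegrableOn u (truncatedCone x₀ a θ r)) (hvi : IntegrableOn v (truncatedCone x₀ a θ r))
    (hfi : IntegrableOn f (truncatedCone x₀ a θ r)) (hgi : IntegrableOn g (truncatedCone x₀ a θ r))
    (hf₀ : HasEssValueAt (truncatedCone x₀ a θ r) f x₀ f₀)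
    (hg₀ : HasEssValueAt (truncatedCone x₀ a θ r) g x₀ g₀)
    (ha : ‖a‖ = 1) (hθ : 0 < θ) (hθ' : θ < Real.pi / 2) (hr : 0 < r) : g₀ = 0 := by
  have horth : ∀ b : R3, ‖b‖ = 1 → inner ℝ a b = 0 →
      dotCL g₀ (dualVec (innerC a)) = 0 ∧ dotCL g₀ (dualVec (innerC b)) = 0 := fun b hb hab => by
    have hpos := hu.dotCL_apex_eq_zero hv hui hvi hfi hgi hf₀ hg₀ ha hθ hθ' hr hb hab
    have hneg := hu.dotCL_apex_eq_zero hv hui hvi hfi hgi hf₀ hg₀ ha hθ hθ' hr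
      ((norm_neg b).trans hb) (by rw [inner_neg_right, hab, neg_zero])
    simp only [map_add, map_neg, map_smul, add_apply, neg_apply, smul_apply, smul_eq_mul,
      dotCL_comm _ g₀] at hpos hneg
    have hIa : Complex.I * dotCL g₀ (dualVec (innerC a)) = 0 := by
      linear_combination (hpos + hneg) / 2
    exact ⟨(mul_eq_zero.1 hIa).resolve_left Complex.I_ne_zero,
      by linear_combination (hpos - hneg) / 2⟩
  obtain ⟨B, rfl⟩ := exists_orthonormalBasis_of_norm_eq_one ha
  refine eq_zero_of_forall_dotCL_dualVec_innerC B fun i => ?_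
  have hB := B.orthonormal
  fin_cases i
  · exact (horth (B 1) (hB.1 1) (hB.2 (by decide))).1
  · exact (horth (B 1) (hB.1 1) (hB.2 (by decide))).2
  · exact (horth (B 2) (hB.1 2) (hB.2 (by decide))).2

end ConicalCorner

section EssentialValue

variable {V : Type*} {K K' : Set R3} {x₀ : R3}

theorem HasEssValueAt.mono [TopologicalSpace V] {f : R3 → V} {v : V} (h : HasEssValueAt K f x₀ v)
    (hK : K' ⊆ K) : HasEssValueAt K' f x₀ v :=
  h.mono_left (inf_le_inf_right _ (ae_mono (Measure.restrict_mono_set _ hK)))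

theorem HasEssValueAt.of_smul_zero {𝕜 : Type*} [NormedField 𝕜] [NormedAddCommGroup V]
    [NormedSpace 𝕜 V] {c : R3 → 𝕜} {c₀ : 𝕜} {u : R3 → V}
    (hcu : HasEssValueAt K (fun x => c x • u x) x₀ 0) (hc : HasEssValueAt K c x₀ c₀)
    (hc₀ : c₀ ≠ 0) : HasEssValueAt K u x₀ 0 := by
  have hlim := (hc.inv₀ hc₀).smul hcu
  rw [smul_zero] at hlim
  exact hlim.congr' ((hc.eventually_ne hc₀).mono fun x hx => inv_smul_smul₀ hx (u x))

theorem IsHolderRepresentative.hasEssValueAt {α : ℝ≥0} (hα : 0 < α) {f F : R3 → C3}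
    (h : IsHolderRepresentative K α f F) (hK : MeasurableSet K) (hx₀ : x₀ ∈ closure K) :
    HasEssValueAt K f x₀ (F x₀) := by
  obtain ⟨⟨_, hC⟩, hFf⟩ := h
  have hF : Tendsto F (𝓝[K] x₀) (𝓝 (F x₀)) :=
    (hC.continuousOn hα x₀ hx₀).mono_left (nhdsWithin_mono _ subset_closure)
  have hle : ae (volume.restrict K) ⊓ 𝓝 x₀ ≤ 𝓝[K] x₀ := by
    rw [nhdsWithin, inf_comm]
    exact inf_le_inf_left _ (le_principal_iff.2 (ae_restrict_mem hK))
  exact (hF.mono_left hle).congr' (hFf.filter_mono inf_le_left)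

end EssentialValue

theorem memLp_gammaCoeff {m : Measure R3} {p : ENNReal} {ε σ : R3 → ℝ} (hε : MemLp ε p m)
    (hσ : MemLp σ p m) (ω : ℝ) : MemLp (gammaCoeff ω ε σ) p m := by
  refine ((hε.ofReal (K := ℂ)).add (hσ.ofReal.const_mul (Complex.I / ω))).ae_eq
    (ae_of_all _ fun x => ?_)
  simp [gammaCoeff, div_mul_eq_mul_div]

section Contrast

variable {Ω B : Set R3} {m : R3 → ℂ} {u v p q : R3 → C3}

theorem integrableOn_inter_smul (hB : volume B ≠ ⊤) (hm : MemLp m ⊤ (volume.restrict Ω))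
    (hp : MemLp p 2 (volume.restrict Ω)) : IntegrableOn (fun x => m x • p x) (Ω ∩ B) :=
  integrableOn_inter_of_memLp_two hB (hp.smul hm)

theorem integrableOn_inter_contrast (hB : volume B ≠ ⊤) (hm : MemLp m ⊤ (volume.restrict Ω))
    (hp : MemLp p 2 (volume.restrict Ω)) (k m₀ : ℂ) :
    IntegrableOn (fun x => k • (m x - m₀) • p x) (Ω ∩ B) := by
  simp only [sub_smul]
  exact ((integrableOn_inter_smul hB hm hp).sub
    ((integrableOn_inter_of_memLp_two hB hp).smul m₀)).smul k

theorem TangentialTraceEqOn.hasZeroTraceCurl_contrast {Γ : Set R3} (hΩ : IsOpen Ω) (hB : IsOpen B)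
    (hBvol : volume B ≠ ⊤) (hBΓ : B ∩ frontier Ω ⊆ Γ) (htr : TangentialTraceEqOn Ω Γ u v)
    {k m₀ : ℂ} (hu : IsWeakCurl Ω u fun x => (k * m x) • p x)
    (hv : IsWeakCurl Ω v fun x => (k * m₀) • q x) (hm : MemLp m ⊤ (volume.restrict Ω))
    (hp : MemLp p 2 (volume.restrict Ω)) (hq : MemLp q 2 (volume.restrict Ω)) :
    HasZeroTraceCurl (Ω ∩ B) B (u - v)
      ((fun x => k • (m x - m₀) • p x) + (k * m₀) • (p - q)) := by
  have hcurl := htr.hasZeroTraceCurl hΩ hB hBvol hBΓ hu hv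
    (integrableOn_inter_smul hBvol (hm.const_mul k) hp)
    ((integrableOn_inter_of_memLp_two hBvol hq).smul (k * m₀))
  convert hcurl using 1
  ext1 x
  simp only [Pi.add_apply, Pi.sub_apply, Pi.smul_apply]
  module

end Contrast

theorem inter_ball_eq_truncatedCone_of_le {Ω : Set R3} {x₀ a : R3} {θ r r' : ℝ} (hr : r ≤ r')
    (hΩ : Ω ∩ Metric.ball x₀ r' = truncatedCone x₀ a θ r') :
    Ω ∩ Metric.ball x₀ r = truncatedCone x₀ a θ r := by
  rw [truncatedCone, ← Set.inter_eq_self_of_subset_right (Metric.ball_subset_ball (x := x₀) hr),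
    ← Set.inter_assoc, ← Set.inter_assoc, hΩ, truncatedCone]

theorem IsRelOpenBoundaryPart.exists_ball_inter_frontier_subset {Ω Γ : Set R3}
    (hΓ : IsRelOpenBoundaryPart Ω Γ) {x₀ : R3} (hx₀ : x₀ ∈ Γ) :
    ∃ ρ, 0 < ρ ∧ Metric.ball x₀ ρ ∩ frontier Ω ⊆ Γ := by
  obtain ⟨U, hU, rfl⟩ := hΓ
  obtain ⟨ρ, hρ, hρU⟩ := Metric.isOpen_iff.1 hU x₀ hx₀.2
  exact ⟨ρ, hρ, fun x hx => ⟨hx.2, hρU hx.1⟩⟩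

theorem apex_eq_zero_of_transmission {Ω Γ : Set R3} (hΩ : IsOpen Ω)
    (hΓ : IsRelOpenBoundaryPart Ω Γ) {k l μ₀ ε₀ : ℂ} (hk : k ≠ 0) (hl : l ≠ 0) {μ γ : R3 → ℂ}
    (hμ : MemLp μ ⊤ (volume.restrict Ω)) (hγ : MemLp γ ⊤ (volume.restrict Ω))
    {Et Ht E0 H0 : R3 → C3}
    (hEt : IsWeakCurl Ω Et fun x => (k * μ x) • Ht x)
    (hHt : IsWeakCurl Ω Ht fun x => (l * γ x) • Et x)
    (hE0 : IsWeakCurl Ω E0 fun x => (k * μ₀) • H0 x)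
    (hH0 : IsWeakCurl Ω H0 fun x => (l * ε₀) • E0 x)
    (hE : TangentialTraceEqOn Ω Γ Et E0) (hH : TangentialTraceEqOn Ω Γ Ht H0)
    {x₀ a : R3} {θ r : ℝ} (hx₀ : x₀ ∈ Γ) (ha : ‖a‖ = 1) (hθ : 0 < θ) (hθ' : θ < Real.pi / 2)
    (hr : 0 < r) (hcorner : Ω ∩ Metric.ball x₀ r = truncatedCone x₀ a θ r) {f₀ g₀ : C3}
    (hf₀ : HasEssValueAt (truncatedCone x₀ a θ r) (fun x => (μ x - μ₀) • Ht x) x₀ f₀)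
    (hg₀ : HasEssValueAt (truncatedCone x₀ a θ r) (fun x => (γ x - ε₀) • Et x) x₀ g₀) :
    f₀ = 0 ∧ g₀ = 0 := by
  obtain ⟨ρ, hρ, hρΓ⟩ := hΓ.exists_ball_inter_frontier_subset hx₀
  have hs : 0 < min ρ r := lt_min hρ hr
  have hK := inter_ball_eq_truncatedCone_of_le (min_le_right ρ r) hcorner
  have hB := Metric.isOpen_ball (x := x₀) (ε := min ρ r)
  have hBvol : volume (Metric.ball x₀ (min ρ r)) ≠ ⊤ := measure_ball_lt_top.ne
  have hBΓ : Metric.ball x₀ (min ρ r) ∩ frontier Ω ⊆ Γ :=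
    (Set.inter_subset_inter_left _ (Metric.ball_subset_ball (min_le_left ρ r))).trans hρΓ
  obtain ⟨⟨_, _, hEtL, hE0L, -⟩, ⟨_, _, hHtL, hH0L, -⟩⟩ := And.intro hE hH
  have hu := hE.hasZeroTraceCurl_contrast hΩ hB hBvol hBΓ hEt hE0 hμ hHtL.memLp hH0L.memLp
  have hv := hH.hasZeroTraceCurl_contrast hΩ hB hBvol hBΓ hHt hH0 hγ hEtL.memLp hE0L.memLp
  have hui := integrableOn_inter_of_memLp_two hBvol (hEtL.memLp.sub hE0L.memLp)
  have hvi := integrableOn_inter_of_memLp_two hBvol (hHtL.memLp.sub hH0L.memLp)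
  have hfi := integrableOn_inter_contrast hBvol hμ hHtL.memLp k μ₀
  have hgi := integrableOn_inter_contrast hBvol hγ hEtL.memLp l ε₀
  rw [hK] at hu hv hui hvi hfi hgi
  have hKsub : truncatedCone x₀ a θ (min ρ r) ⊆ truncatedCone x₀ a θ r :=
    Set.inter_subset_inter_right _ (Metric.ball_subset_ball (min_le_right ρ r))
  have hf := (hf₀.mono hKsub).const_smul k
  have hg := (hg₀.mono hKsub).const_smul l
  exact ⟨(smul_eq_zero.1 (hv.apex_eq_zero hu hvi hui hgi hfi hg hf ha hθ hθ' hs)).resolve_left hk,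
    (smul_eq_zero.1 (hu.apex_eq_zero hv hui hvi hfi hgi hf hg ha hθ hθ' hs)).resolve_left hl⟩

theorem theorem4p1_general {Ω Γ : Set R3} (hΩ : IsOpen Ω) (hΓ : IsRelOpenBoundaryPart Ω Γ)
    {ω ε₀ μ₀ : ℂ} (hω : ω ≠ 0) {μ γ : R3 → ℂ} (hμ : MemLp μ ⊤ (volume.restrict Ω))
    (hγ : MemLp γ ⊤ (volume.restrict Ω)) {Et Ht E0 H0 : R3 → C3}
    (hEt : IsWeakCurl Ω Et fun x => (Complex.I * ω * μ x) • Ht x)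
    (hHt : IsWeakCurl Ω Ht fun x => (-(Complex.I * ω * γ x)) • Et x)
    (hE0 : IsWeakCurl Ω E0 fun x => (Complex.I * ω * μ₀) • H0 x)
    (hH0 : IsWeakCurl Ω H0 fun x => (-(Complex.I * ω * ε₀)) • E0 x)
    (hE : TangentialTraceEqOn Ω Γ Et E0) (hH : TangentialTraceEqOn Ω Γ Ht H0)
    {x₀ a : R3} {θ r : ℝ} (hx₀ : x₀ ∈ Γ) (ha : ‖a‖ = 1) (hθ : 0 < θ) (hθ' : θ < Real.pi / 2)
    (hr : 0 < r) (hcorner : Ω ∩ Metric.ball x₀ r = truncatedCone x₀ a θ r) {f₀ g₀ : C3}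
    (hf₀ : HasEssValueAt (truncatedCone x₀ a θ r) (fun x => (μ x - μ₀) • Ht x) x₀ f₀)
    (hg₀ : HasEssValueAt (truncatedCone x₀ a θ r) (fun x => (γ x - ε₀) • Et x) x₀ g₀) :
    f₀ = 0 ∧ g₀ = 0 ∧
    (∀ m : ℂ, HasEssValueAt (truncatedCone x₀ a θ r) μ x₀ m → m ≠ μ₀ →
      HasEssValueAt (truncatedCone x₀ a θ r) Ht x₀ 0) ∧
    (∀ g : ℂ, HasEssValueAt (truncatedCone x₀ a θ r) γ x₀ g → g ≠ ε₀ →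
      HasEssValueAt (truncatedCone x₀ a θ r) Et x₀ 0) := by
  have hk : Complex.I * ω ≠ 0 := mul_ne_zero Complex.I_ne_zero hω
  simp only [← neg_mul (Complex.I * ω)] at hHt hH0
  obtain ⟨rfl, rfl⟩ := apex_eq_zero_of_transmission hΩ hΓ hk (neg_ne_zero.2 hk) hμ hγ hEt hHt hE0
    hH0 hE hH hx₀ ha hθ hθ' hr hcorner hf₀ hg₀
  exact ⟨rfl, rfl, fun m hm hne => hf₀.of_smul_zero (hm.sub_const μ₀) (sub_ne_zero.2 hne),
    fun g hg hne => hg₀.of_smul_zero (hg.sub_const ε₀) (sub_ne_zero.2 hne)⟩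

theorem theorem4p1
    (Ω Γ : Set R3) (hΩ : IsBoundedLipschitzDomain Ω) (hΓ : IsRelOpenBoundaryPart Ω Γ)
    (ω ε₀ μ₀ : ℝ) (hω : 0 < ω) (hε₀ : 0 < ε₀) (hμ₀ : 0 < μ₀)
    (ε μ σ : R3 → ℝ) (hmed : IsMedium Ω ε μ σ)
    (Et Ht E0 H0 : R3 → C3)
    (heig : IsTransmissionEigenfunctions Ω Γ ω ε₀ μ₀ ε μ σ Et Ht E0 H0)
    -- the conical corner of `Ω` with apex `x₀ ∈ Γ`
    (x₀ a : R3) (θ₀ r₀ : ℝ) (hx₀ : x₀ ∈ Γ) (ha : ‖a‖ = 1)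
    (hθ₀ : 0 < θ₀) (hθ₀' : θ₀ < Real.pi / 2) (hr₀ : 0 < r₀)
    (hcorner : Ω ∩ Metric.ball x₀ r₀ = truncatedCone x₀ a θ₀ r₀)
    -- Hölder regularity of `(μ - μ₀) H^t` and `(γ - ε₀) E^t` up to the boundary of the corner
    (α : ℝ≥0) (hα : 0 < α) (hα' : α < 1) (F G : R3 → C3)
    (hF : IsHolderRepresentative (truncatedCone x₀ a θ₀ r₀) α
      (fun x => ((μ x : ℂ) - (μ₀ : ℂ)) • Ht x) F)
    (hG : IsHolderRepresentative (truncatedCone x₀ a θ₀ r₀) α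
      (fun x => (gammaCoeff ω ε σ x - (ε₀ : ℂ)) • Et x) G) :
    F x₀ = 0 ∧ G x₀ = 0 ∧
    (∀ m : ℝ, HasEssValueAt (truncatedCone x₀ a θ₀ r₀) μ x₀ m → m ≠ μ₀ →
      HasEssValueAt (truncatedCone x₀ a θ₀ r₀) Ht x₀ 0) ∧
    (∀ g : ℂ, HasEssValueAt (truncatedCone x₀ a θ₀ r₀) (gammaCoeff ω ε σ) x₀ g →
      g ≠ (ε₀ : ℂ) → HasEssValueAt (truncatedCone x₀ a θ₀ r₀) Et x₀ 0) := by
  have hK : MeasurableSet (truncatedCone x₀ a θ₀ r₀) :=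
    hcorner ▸ (hΩ.isOpen.inter Metric.isOpen_ball).measurableSet
  have hmem : x₀ ∈ closure (truncatedCone x₀ a θ₀ r₀) :=
    mem_closure_truncatedCone (norm_ne_zero_iff.1 (ha ▸ one_ne_zero)) hθ₀ hr₀
  obtain ⟨hF₀, hG₀, hHt₀, hEt₀⟩ := theorem4p1_general hΩ.isOpen hΓ
    (Complex.ofReal_ne_zero.2 hω.ne') hmed.memLp_mu.ofReal
    (memLp_gammaCoeff hmed.memLp_eps hmed.memLp_sigma ω) heig.curl_Et heig.curl_Ht heig.curl_E0
    heig.curl_H0 heig.trace_E heig.trace_H hx₀ ha hθ₀ hθ₀' hr₀ hcorner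
    (hF.hasEssValueAt hα hK hmem) (hG.hasEssValueAt hα hK hmem)
  exact ⟨hF₀, hG₀, fun m hm hne => hHt₀ m ((Complex.continuous_ofReal.tendsto m).comp hm)
    (mt Complex.ofReal_injective.eq_iff.1 hne), hEt₀⟩
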